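/- **Setting.** Fix $\kappa\ge 1$. A *$\kappa$-color box-ball configuration* is a map $Y:\mathbb N=\{1,2,\dots\}\to\{0,1,\dots,\kappa\}$ with finite support; $Y(x)=0$ means that box $x$ is empty and $Y(x)=a\ge1$ that it holds a ball of color $a$. For $1\le a\le\kappa$ let $K_a$ be the operator that moves the balls of color $a$ (those present at the beginning), one after the other from left to right and each once, to the leftmost empty box to their right. The time evolution is $Y\mapsto K_1\circ K_2\circ\cdots\circ K_\kappa(Y)$. Iterating it, the system eventually decomposes into *solitons*: from some time on, the list, from left to right, of the maximal non-increasing sequences of balls in consecutive (occupied) boxes is constant (lengths and colors no longer change), and its lengths are non-decreasing from left. Let $\lambda_j(Y)$, $j\ge1$, be the length of the $j$-th longest of these solitons, with $\lambda_j(Y)=0$ if there are fewer than $j$. Let $X:\mathbb N\to\{0,\dots,\kappa\}$ have independent entries $X(x)$, $x\in\mathbb N$, with a common distribution $\mathbf p=(p_0,\dots,p_\kappa)$, let $X^{n}(x)=X(x)\mathbf 1(1\le x\le n)$, and put $\lambda_j(n)=\lambda_j(X^{n})$. The *infinite capacity carrier process* $(\Gamma_t)_{t\ge0}$ over $X$ takes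 values in the non-increasing sequences in $\{0,\dots,\kappa\}^{\mathbb N}$ with finite support: $\Gamma_0=[0,0,\dots]$, and with $y=X(t+1)$: if $y\ge1$, $\Gamma_{t+1}$ is $\Gamma_t$ with its first entry smaller than $y$ replaced by $y$; if $y=0$, $\Gamma_{t+1}(i)=\Gamma_t(i+1)$ for all $i\ge 1$. Let $m_i(\Gamma_t)$ be the number of entries of $\Gamma_t$ equal to $i$, $S\Gamma_t=(m_1(\Gamma_t),\dots,m_\kappa(\Gamma_t))$ and $\lVert S\Gamma_t\rVert_1=\sum_{i=1}^\kappa m_i(\Gamma_t)$. Let $M_n=\sum_{t=1}^n\mathbf 1(S\Gamma_t=\mathbf 0)$, let $T_0=0$, and for $k\ge1$ let $T_k\in\mathbb N\cup\{\infty\}$ be the time of the $k$-th visit of $(S\Gamma_t)_{t\ge1}$ to $\mathbf 0$ ($T_k=\infty$ if there are fewer than $k$ visits). The height of the $k$-th excursion is $$h_k=\sup\{\lVert S\Gamma_t\rVert_1 : t\in\mathbb Z_{\ge0},\ T_{k-1}\le t\le T_k\}\in\mathbb Z_{\ge0}\cup\{\infty\}.$$ Let $\mathbf h_1(n)\ge\mathbf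 h_2(n)\ge\cdots\ge\mathbf h_{M_n}(n)$ be the order statistics of $h_1,\dots,h_{M_n}$, and $\mathbf h_j(n)=0$ for $j>M_n$. The maximum of an empty list is $0$. **Lemma.** For every realization of $X$ and every $n\ge1$, the soliton decomposition of $X^{n}$ exists (so that the $\lambda_j(n)$ are well defined), and 1. $\max\{h_1,\dots,h_{M_n}\}\le\lambda_1(n)\le\max\{h_1,\dots,h_{M_n+1}\}$; 2. $\lambda_j(n)\ge\mathbf h_j(n)$ for every $j\ge1$. -/

import Mathlib

open Filter MeasureTheory ProbabilityTheory

noncomputable section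

namespace BoxBall

/-! ### The `κ`-color box-ball system

Boxes are indexed by `ℕ` starting from `0`, so that the box `x : ℕ` is the `(x + 1)`-st box from
the left.  The color `0` means that the box is empty. -/

/-- A `κ`-color BBS configuration with finite support. -/
abbrev Config (κ : ℕ) := ℕ →₀ Fin (κ + 1)

/-- The leftmost empty box strictly to the right of the box `x` (there is one, since only finitely
many boxes are occupied). -/
def nextEmpty {κ : ℕ} (Y : Config κ) (x : ℕ) : ℕ := sInf {y | x < y ∧ Y y = 0}

theorem nextEmpty_spec {κ : ℕ} (Y : Config κ) (x : ℕ) :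
    x < nextEmpty Y x ∧ Y (nextEmpty Y x) = 0 := by
  have h : {y | x < y ∧ Y y = 0}.Nonempty := by
    obtain ⟨y, hy⟩ := Infinite.exists_notMem_finset (Finset.range (x + 1) ∪ Y.support)
    simp only [Finset.mem_union, Finset.mem_range, Finsupp.mem_support_iff, not_or, not_not] at hy
    exact ⟨y, by omega, hy.2⟩
  exact Nat.sInf_mem h

/-- Move the ball in the box `x` to the leftmost empty box to its right. -/
def moveBall {κ : ℕ} (Y : Config κ) (x : ℕ) : Config κ :=
  (Y.update x 0).update (nextEmpty Y x) (Y x)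

/-- The operator `K_a`: the balls which have color `a` at the beginning move one after the other,
from left to right, each exactly once. -/
def jump {κ : ℕ} (a : Fin (κ + 1)) (Y : Config κ) : Config κ :=
  ((Y.support.filter fun x => Y x = a).sort (· ≤ ·)).foldl moveBall Y

/-- One step `K_1 ∘ K_2 ∘ ⋯ ∘ K_κ` of the BBS time evolution. -/
def evolve {κ : ℕ} (Y : Config κ) : Config κ :=
  (List.finRange κ).foldr (fun i Z => jump i.succ Z) Y

/-- The maximal sequences of balls (of positive color) in consecutive boxes with non-increasing
colors, listed from left to right; each one is recorded as the word of its colors.  All boxes to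
the right of the box `Y.support.sup id` are empty. -/
def ballRuns {κ : ℕ} (Y : Config κ) : List (List (Fin (κ + 1))) :=
  (((List.range (Y.support.sup id + 1)).map Y).splitBy
    fun a b => decide (0 < b ∧ b ≤ a)).filter fun w => decide (w ≠ [0])

/-- `L` lists the solitons, from left to right, into which the system started at `Y` eventually
decomposes: from some time on, the maximal non-increasing sequences of balls are those in `L`,
their lengths and contents no longer change, and their lengths are non-decreasing from left. -/
def IsSolitonDecomposition {κ : ℕ} (Y : Config κ) (L : List (List (Fin (κ + 1)))) : Prop :=
  (∀ᶠ t : ℕ in atTop, ballRuns (evolve^[t] Y) = L) ∧ (L.map List.length).Pairwise (· ≤ ·)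

/-- The `j`-th largest entry of a list (`j = 1, 2, …`), with multiplicity; `0` if the list has less
than `j` entries. -/
def nthLargest {α : Type*} [LinearOrder α] [Zero α] (l : List α) (j : ℕ) : α :=
  (l.mergeSort fun a b => decide (b ≤ a)).getD (j - 1) 0

open Classical in
/-- The length `λ_j(Y)` of the `j`-th longest soliton, that is, the length of the `j`-th column of
the Young diagram of `Y`; it is `0` if there are less than `j` solitons. -/
def solitonLength {κ : ℕ} (Y : Config κ) (j : ℕ) : ℕ :=
  if h : ∃ L, IsSolitonDecomposition Y L then nthLargest (h.choose.map List.length) j else 0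

/-- The configuration that agrees with `X` on the first `n` boxes and is empty elsewhere. -/
def truncate {κ : ℕ} (X : ℕ → Fin (κ + 1)) (n : ℕ) : Config κ :=
  Finsupp.onFinset (Finset.range n) (fun x => if x < n then X x else 0) (by
    intro x hx
    by_contra h
    exact hx (if_neg (by simpa using h)))

/-! ### The infinite capacity carrier process -/

/-- The states of the infinite capacity carrier: non-increasing sequences of colors with finite
support.  The entries are indexed from `0`. -/
def Carrier (κ : ℕ) := {g : ℕ →₀ Fin (κ + 1) // Antitone g}

/-- The index of the first entry that is smaller than `y` (there is one if `y` is positive). -/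
def firstSmaller {κ : ℕ} (g : Carrier κ) (y : Fin (κ + 1)) : ℕ := sInf {i | g.1 i < y}

theorem firstSmaller_spec {κ : ℕ} (g : Carrier κ) {y : Fin (κ + 1)} (hy : y ≠ 0) :
    g.1 (firstSmaller g y) < y ∧ ∀ i < firstSmaller g y, y ≤ g.1 i := by
  have h : {i | g.1 i < y}.Nonempty := by
    obtain ⟨i, hi⟩ := Infinite.exists_notMem_finset g.1.support
    rw [Finsupp.notMem_support_iff] at hi
    exact ⟨i, by simpa [hi] using Fin.pos_of_ne_zero hy⟩
  exact ⟨Nat.sInf_mem h, fun i hi => not_lt.1 fun h' =>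
    Nat.notMem_of_lt_sInf (s := {i | g.1 i < y}) hi h'⟩

/-- The circular exclusion rule: the next state of the carrier in state `g` when it meets the color
`y`.  A ball replaces the first entry that is smaller than it; an empty box removes the largest
entry. -/
def Carrier.next {κ : ℕ} (g : Carrier κ) (y : Fin (κ + 1)) : Carrier κ :=
  if hy : y = 0 then
    ⟨g.1.comapDomain (fun i => i + 1) (fun _ _ _ _ h => Nat.succ_injective h),
      fun i j hij => g.2 (Nat.succ_le_succ hij)⟩
  else
    ⟨g.1.update (firstSmaller g y) y, fun i j hij => by
      obtain ⟨h1, h2⟩ := firstSmaller_spec g hy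
      simp only [Finsupp.coe_update, Function.update_apply]
      split_ifs with hj hi hi
      · exact le_rfl
      · exact h2 i (lt_of_le_of_ne (hj ▸ hij) hi)
      · exact (g.2 (hi ▸ hij)).trans h1.le
      · exact g.2 hij⟩

/-- The infinite capacity carrier process `Γ_t` over `X`, started from the empty carrier. -/
def carrier {κ : ℕ} (X : ℕ → Fin (κ + 1)) : ℕ → Carrier κ
  | 0 => ⟨0, antitone_const⟩
  | t + 1 => (carrier X t).next (X t)

/-- `SΓ_t = (m_1(Γ_t), …, m_κ(Γ_t))`: the number of balls of each positive color in the carrier. -/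
def carrierCount {κ : ℕ} (X : ℕ → Fin (κ + 1)) (t : ℕ) : Fin κ → ℕ :=
  fun i => {j | (carrier X t).1 j = i.succ}.ncard

/-- The height `‖SΓ_t‖₁` of the carrier at time `t`. -/
def height {κ : ℕ} (X : ℕ → Fin (κ + 1)) (t : ℕ) : ℕ := ∑ i, carrierCount X t i

/-- `M_n`: the number of visits of `SΓ` to the origin during `[1, n]`. -/
def numVisits {κ : ℕ} (X : ℕ → Fin (κ + 1)) (n : ℕ) : ℕ :=
  ((Finset.Icc 1 n).filter fun t => carrierCount X t = 0).card

/-- `T_k`: the time of the `k`-th visit of `SΓ` to the origin during `[1, ∞)`, and `T_0 = 0`.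
It is `⊤` if there are less than `k` visits. -/
def visitTime {κ : ℕ} (X : ℕ → Fin (κ + 1)) : ℕ → ℕ∞
  | 0 => 0
  | k + 1 => sInf {s | ∃ t : ℕ, s = t ∧ visitTime X k < t ∧ carrierCount X t = 0}

/-- The height `h_k` (`k = 1, 2, …`) of the `k`-th excursion, the largest height of the carrier
during `[T_{k-1}, T_k]`.  If the excursion never ends (`T_k = ⊤`), this is a supremum over an
unbounded set of times, which may be infinite. -/
def excursionHeight {κ : ℕ} (X : ℕ → Fin (κ + 1)) (k : ℕ) : ℕ∞ :=
  ⨆ t ∈ {t : ℕ | visitTime X (k - 1) ≤ t ∧ (t : ℕ∞) ≤ visitTime X k}, (height X t : ℕ∞)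

/-- The maximum of `h_1, …, h_m` (which is `0` for `m = 0`). -/
def maxExcursionHeight {κ : ℕ} (X : ℕ → Fin (κ + 1)) (m : ℕ) : ℕ∞ :=
  (Finset.Icc 1 m).sup (excursionHeight X)

/-- The `j`-th largest (`j = 1, 2, …`) of the heights `h_1, …, h_{M_n}` of the excursions that are
completed by time `n`; it is `0` if `j > M_n`. -/
def orderedHeight {κ : ℕ} (X : ℕ → Fin (κ + 1)) (n j : ℕ) : ℕ∞ :=
  nthLargest ((List.range (numVisits X n)).map fun k => excursionHeight X (k + 1)) j

end BoxBall

end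

/-!
The proof tracks carriers through threshold counts: the energies for finite capacities are conserved
by the time evolution, the runs of balls stabilize, and the energies of the stable runs give the
soliton lengths, which are then compared with the heights of the excursions.
-/

namespace BoxBall

/-! ### Carriers described by their threshold counts

A carrier is described by the numbers `N v` of its entries that are at least `v`. -/

/-! Let E_c be the number of times a carrier of capacity c replaces a strictly smaller entry by an
incoming ball. The proof evaluates E_{c+1} - E_c in two ways, for every c.

Solitons: E_c is conserved and equals the sum of min(length, c) over the solitons, so E_{c+1} - E_c
counts the solitons of length at least c + 1. For the conservation (`energy_evolve`), one evolution
is split into κ steps `rotHop`, each a jump of the largest color followed by a cyclic renaming. A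
local exchange relation between carrier and jump queue (`Linked`) shows that such a step changes E_c
only by the number of balls of color κ still in the carrier, which is finally zero. For the value,
the evolved configuration is the word released by the infinite capacity carrier (`colors_evolve`).
Its runs start exactly where the input runs end, so their number is preserved. The first i runs
never gain balls of color at least v (`ballCount_evolve_le`), so these finitely many integers
settle, and so do the runs. A settled run moves at a speed equal to its length, hence lengths are
non-decreasing from the left. A settled run finds no blocking leftover in the carrier, so it
contributes min(length, c) to E_c (`IsStable.energy_eq`).

Excursions: E_c of the truncated configuration is the count for X up to time n, since empty boxes
contribute nothing. From an empty carrier, the capacities c and c + 1 act like infinite capacity as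
long as they accept the same balls, and this must fail before height c + 1 is reached. So every
completed excursion of height at least c + 1 adds at least one to E_{c+1} - E_c
(`energy_add_card_le`), while the difference vanishes if the height stays at most c up to n
(`energy_succ_eq_of_pile_le`). The first fact bounds the ordered heights by the soliton lengths, the
second bounds the longest soliton. -/

/-- The circular exclusion rule for a carrier with exactly `c` entries: a letter `y` that exceeds
the smallest entry replaces the largest entry below `y`; any other letter replaces the largest
entry. -/
def insertLetter (c : ℕ) (N : ℕ → ℕ) (y v : ℕ) : ℕ :=
  if N y < c then (if v ≤ y ∧ N v = N y then N v + 1 else N v)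
  else if y < v then N v - 1 else N v

/-- The threshold counts at time `t` of the carrier with capacity `c` over `Y`. -/
def load (c : ℕ) (Y : ℕ → ℕ) : ℕ → ℕ → ℕ
  | 0 => fun v => if v = 0 then c else 0
  | t + 1 => insertLetter c (load c Y t) (Y t)

/-- The circular exclusion rule for the carrier with infinite capacity. -/
def pushLetter (N : ℕ → ℕ) (y v : ℕ) : ℕ :=
  if y = 0 then N v - 1 else if v ≤ y ∧ N v = N y then N v + 1 else N v

/-- The threshold counts at time `t` of the carrier with infinite capacity over `Y`.  The
threshold `0` is treated like `1`, the infinitely many empty entries being ignored. -/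
def pile (Y : ℕ → ℕ) : ℕ → ℕ → ℕ
  | 0 => fun _ => 0
  | t + 1 => pushLetter (pile Y t) (Y t)

/-- The indicator that the carrier with capacity `c` replaces a smaller letter at time `t`. -/
def gain (c : ℕ) (Y : ℕ → ℕ) (t : ℕ) : ℕ := if load c Y t (Y t) < c then 1 else 0

/-- The energy of `Y` for the capacity `c`, up to time `T`. -/
def energy (c : ℕ) (Y : ℕ → ℕ) (T : ℕ) : ℕ := ∑ t ∈ Finset.range T, gain c Y t

theorem energy_succ (c : ℕ) (Y : ℕ → ℕ) (T : ℕ) :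
    energy c Y (T + 1) = energy c Y T + gain c Y T := Finset.sum_range_succ _ _

theorem load_zero_right (c : ℕ) (Y : ℕ → ℕ) (t : ℕ) : load c Y t 0 = c := by
  induction t with
  | zero => simp [load]
  | succ t ih =>
    simp only [load, insertLetter, ih]
    split_ifs <;> omega

theorem load_antitone (c : ℕ) (Y : ℕ → ℕ) (t : ℕ) : Antitone (load c Y t) := by
  induction t with
  | zero =>
    intro v w h
    simp only [load]
    split_ifs <;> omega
  | succ t ih =>
    intro v w h
    have h1 := ih h
    have h2 : v ≤ Y t → load c Y t (Y t) ≤ load c Y t v := fun h => ih h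
    have h3 : Y t < v → load c Y t v ≤ load c Y t (Y t) := fun h => ih h.le
    simp only [load, insertLetter]
    split_ifs <;> omega

theorem load_le (c : ℕ) (Y : ℕ → ℕ) (t v : ℕ) : load c Y t v ≤ c :=
  (load_antitone c Y t (Nat.zero_le v)).trans (load_zero_right c Y t).le

theorem pile_antitone (Y : ℕ → ℕ) (t : ℕ) : Antitone (pile Y t) := by
  induction t with
  | zero => intro v w _; simp [pile]
  | succ t ih =>
    intro v w h
    have h1 := ih h
    have h2 : v ≤ Y t → pile Y t (Y t) ≤ pile Y t v := fun h => ih h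
    have h3 : Y t < v → pile Y t v ≤ pile Y t (Y t) := fun h => ih h.le
    simp only [pile, pushLetter]
    split_ifs <;> omega

theorem pile_le_time (Y : ℕ → ℕ) (t v : ℕ) : pile Y t v ≤ t := by
  induction t with
  | zero => simp [pile]
  | succ t ih =>
    simp only [pile, pushLetter]
    split_ifs <;> omega

/-- One letter adds at most one ball, so the capacity is not felt during the first `c` letters. This
lets bounds between finite capacities pass to the infinite one. -/
theorem load_eq_pile (Y : ℕ → ℕ) {c t v : ℕ} (ht : t ≤ c) (hv : v ≠ 0) :
    load c Y t v = pile Y t v := by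
  induction t generalizing v with
  | zero => simp [load, pile, hv]
  | succ t ih =>
    have h1 := ih (by omega) hv
    have h2 := pile_le_time Y t (Y t)
    have h3 : Y t ≠ 0 → load c Y t (Y t) = pile Y t (Y t) := ih (by omega)
    have h4 : Y t = 0 → load c Y t (Y t) = c := fun h => h ▸ load_zero_right c Y t
    simp only [load, pile, insertLetter, pushLetter]
    split_ifs <;> omega

/-- The carrier with the smaller capacity is contained in that with the larger one. -/
theorem load_sub {c C : ℕ} (hc : c ≤ C) (Y : ℕ → ℕ) (t : ℕ) :
    (∀ v, load c Y t v ≤ load C Y t v) ∧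
      ∀ v w, v ≤ w → load C Y t w + load c Y t v ≤ load C Y t v + load c Y t w := by
  induction t with
  | zero =>
    constructor
    · intro v
      simp only [load]
      split_ifs <;> omega
    · intro v w h
      simp only [load]
      split_ifs <;> omega
  | succ t ih =>
    obtain ⟨ih1, ih2⟩ := ih
    set y := Y t with hy
    have e : ∀ v, v ≤ y → load c Y t y ≤ load c Y t v ∧ load C Y t y ≤ load C Y t v ∧
        load C Y t y + load c Y t v ≤ load C Y t v + load c Y t y := fun v h =>
      ⟨load_antitone c Y t h, load_antitone C Y t h, ih2 v y h⟩
    have e' : ∀ v, y < v → load c Y t v ≤ load c Y t y ∧ load C Y t v ≤ load C Y t y ∧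
        load C Y t v + load c Y t y ≤ load C Y t y + load c Y t v := fun v h =>
      ⟨load_antitone c Y t h.le, load_antitone C Y t h.le, ih2 y v h.le⟩
    -- At threshold `0` the second invariant compares the numbers of entries below `y`: a letter
    -- accepted by the smaller carrier is accepted by the larger one.
    have h0 := ih2 0 y (Nat.zero_le _)
    rw [load_zero_right, load_zero_right] at h0
    have hy1 := ih1 y
    have hle := load_le c Y t y
    have hle' := load_le C Y t y
    constructor
    · intro v
      have h1 := ih1 v
      have h2 := e v
      have h3 := e' v
      have h4 := load_le c Y t v
      simp only [load, insertLetter, ← hy]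
      split_ifs <;> omega
    · intro v w h
      have h1 := ih1 v
      have h1w := ih1 w
      have h2 := e v
      have h3 := e' v
      have h2w := e w
      have h3w := e' w
      have h4 := load_le c Y t v
      have h4w := load_le c Y t w
      have h5 := ih2 v w h
      have h6 := load_antitone c Y t h
      have h7 := load_antitone C Y t h
      simp only [load, insertLetter, ← hy]
      split_ifs <;> omega

theorem load_le_pile (c : ℕ) (Y : ℕ → ℕ) (t : ℕ) {v : ℕ} (hv : v ≠ 0) :
    load c Y t v ≤ pile Y t v := by
  rw [← load_eq_pile Y (le_max_right c t) hv]
  exact (load_sub (le_max_left c t) Y t).1 v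

theorem gain_mono {c C : ℕ} (hc : c ≤ C) (Y : ℕ → ℕ) (t : ℕ) : gain c Y t ≤ gain C Y t := by
  have h := (load_sub hc Y t).2 0 (Y t) (Nat.zero_le _)
  rw [load_zero_right, load_zero_right] at h
  simp only [gain]
  split_ifs <;> omega

theorem gain_of_eq_zero (c : ℕ) {Y : ℕ → ℕ} {t : ℕ} (h : Y t = 0) : gain c Y t = 0 := by
  simp [gain, h, load_zero_right]

theorem energy_eq_of_zero (c : ℕ) {Y : ℕ → ℕ} {T T' : ℕ} (hT : T ≤ T')
    (hY : ∀ x, T ≤ x → Y x = 0) : energy c Y T' = energy c Y T := by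
  refine (Finset.sum_subset (Finset.range_mono hT) fun x _ hx => ?_).symm
  exact gain_of_eq_zero c (hY x (by simpa using hx))

/-- Each empty box takes out the largest entry, and there are only `c` entries. -/
theorem load_eq_zero_of_zero (c : ℕ) {Y : ℕ → ℕ} {T t v : ℕ} (hY : ∀ x, T ≤ x → Y x = 0)
    (ht : T + c ≤ t) (hv : v ≠ 0) : load c Y t v = 0 := by
  have key : ∀ k, load c Y (T + k) v ≤ c - k := by
    intro k
    induction k with
    | zero => exact load_le c Y T v
    | succ k ih =>
      have h0 := hY (T + k) (by omega)
      have h1 := load_zero_right c Y (T + k)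
      rw [← add_assoc]
      simp only [load, insertLetter, h0, h1]
      split_ifs <;> omega
  have := key (t - T)
  rw [show T + (t - T) = t by omega] at this
  omega

/-! ### One color at a time -/

/-- The number of balls in a queue that runs over `Y`, picks up the letters `a` and drops one ball
in each empty box. -/
def queue (a : ℕ) (Y : ℕ → ℕ) : ℕ → ℕ
  | 0 => 0
  | t + 1 => if Y t = a then queue a Y t + 1 else if Y t = 0 then queue a Y t - 1 else queue a Y t

/-- The configuration after the balls of color `a` have jumped. -/
def hop (a : ℕ) (Y : ℕ → ℕ) (x : ℕ) : ℕ :=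
  if Y x = a then 0 else if Y x = 0 ∧ 0 < queue a Y x then a else Y x

/-- The cyclic rotation of the positive colors. -/
def rot (κ a : ℕ) : ℕ := if a = 0 then 0 else if a = κ then 1 else a + 1

/-- The jump of the balls of the largest color, which then becomes the smallest one. -/
def rotHop (κ : ℕ) (Y : ℕ → ℕ) (x : ℕ) : ℕ := rot κ (hop κ Y x)

/-- The threshold counts `N` of a carrier with capacity `c` over `Y` and those `M` of the carrier
over `rotHop κ Y` are related through the number `k` of balls in the queue over `Y` and the number
`m` of balls in the queue over the output of the first carrier. -/
structure Linked (κ c : ℕ) (N M : ℕ → ℕ) (k m : ℕ) : Prop where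
  count : k = (m + N 1 - c) + N κ
  one : M 1 = min (c - N κ) (m + N 1 - N κ)
  succ : ∀ v, 1 ≤ v → v < κ → M (v + 1) = N v - N κ
  big : ∀ v, κ < v → N v = 0
  big' : ∀ v, κ < v → M v = 0

theorem Linked.step_top {κ c k m : ℕ} {N M : ℕ → ℕ} (hκ : 1 ≤ κ) (h : Linked κ c N M k m)
    (hN : Antitone N) (hc : ∀ v, N v ≤ c) (hM0 : M 0 = c) :
    ∃ m', Linked κ c (insertLetter c N κ) (insertLetter c M 0) (k + 1) m' := by
  obtain ⟨h1, h2, h3, h4, h5⟩ := h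
  have hκ1 : N κ ≤ N 1 := hN hκ
  have hκ1' : κ = 1 → N κ = N 1 := fun h => by rw [h]
  have hc1 := hc 1
  -- The queue `m` reads the letter that the carrier releases: it is `κ` if the carrier is full of
  -- `κ`, and `0` if no entry lies strictly between `0` and `κ`.
  refine ⟨if N κ = c then m + 1 else if N 1 = N κ then m - 1 else m, ?_, ?_, ?_, ?_, ?_⟩
  · simp only [insertLetter, le_refl, and_self, if_true]
    split_ifs <;> omega
  · simp only [insertLetter, le_refl, and_self, if_true]
    split_ifs <;> omega
  · intro v hv hv'
    have := h3 v hv hv'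
    have := hc v
    have : v = 1 → N v = N 1 := fun h => by rw [h]
    have : N κ ≤ N v := hN hv'.le
    simp only [insertLetter, le_refl, and_self, if_true]
    split_ifs <;> omega
  · intro v hv
    have := h4 v hv
    simp only [insertLetter]
    split_ifs <;> omega
  · intro v hv
    have := h5 v hv
    simp only [insertLetter]
    split_ifs <;> omega

theorem Linked.step_zero {κ c k m : ℕ} {N M : ℕ → ℕ} (hκ : 1 ≤ κ) (h : Linked κ c N M k m)
    (hN : Antitone N) (hc : ∀ v, N v ≤ c) (hN0 : N 0 = c) (hM0 : M 0 = c) :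
    ∃ m', Linked κ c (insertLetter c N 0) (insertLetter c M (if 0 < k then 1 else 0)) (k - 1)
      m' := by
  obtain ⟨h1, h2, h3, h4, h5⟩ := h
  have hκ1 : N κ ≤ N 1 := hN hκ
  have hκ1' : κ = 1 → N κ = N 1 := fun h => by rw [h]
  have hc1 := hc 1
  -- An empty box releases the largest entry, which is `κ`, `0`, or a color in between.
  refine ⟨if 0 < N κ then m + 1 else if N 1 = 0 then m - 1 else m, ?_, ?_, ?_, ?_, ?_⟩
  · simp only [insertLetter]
    split_ifs <;> omega
  · by_cases hk : 0 < k <;> simp only [hk, if_true, if_false, insertLetter, le_refl, and_self] <;>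
    split_ifs <;> omega
  · intro v hv hv'
    have := h3 v hv hv'
    have := hc v
    have : v = 1 → N v = N 1 := fun h => by rw [h]
    have : N κ ≤ N v := hN hv'.le
    have : N v ≤ N 1 := hN hv
    by_cases hk : 0 < k <;> simp only [hk, if_true, if_false, insertLetter] <;>
    split_ifs <;> omega
  · intro v hv
    have := h4 v hv
    simp only [insertLetter]
    split_ifs <;> omega
  · intro v hv
    have := h5 v hv
    by_cases hk : 0 < k <;> simp only [hk, if_true, if_false, insertLetter] <;>
    split_ifs <;> omega

theorem Linked.step_mid {κ c k m y : ℕ} {N M : ℕ → ℕ} (hκ : 1 ≤ κ) (h : Linked κ c N M k m)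
    (hN : Antitone N) (hc : ∀ v, N v ≤ c) (hy : 1 ≤ y) (hy' : y < κ) :
    ∃ m', Linked κ c (insertLetter c N y) (insertLetter c M (y + 1)) k m' := by
  obtain ⟨h1, h2, h3, h4, h5⟩ := h
  have hκ1 : N κ ≤ N 1 := hN hκ
  have hκ1' : κ = 1 → N κ = N 1 := fun h => by rw [h]
  have hc1 := hc 1
  have hcy := hc y
  have hy1 : N y ≤ N 1 := hN hy
  have hyκ : N κ ≤ N y := hN hy'.le
  have hMy := h3 y hy hy'
  -- If `y` is accepted, the released letter is below `y`, and it is `0` exactly if `N 1 = N y`.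
  -- Otherwise the largest entry leaves.
  refine ⟨if N y < c then (if N 1 = N y then m - 1 else m) else
    if 0 < N κ then m + 1 else m, ?_, ?_, ?_, ?_, ?_⟩
  · simp only [insertLetter]
    split_ifs <;> omega
  · simp only [insertLetter]
    split_ifs <;> omega
  · intro v hv hv'
    have := h3 v hv hv'
    have := hc v
    have : v = 1 → N v = N 1 := fun h => by rw [h]
    have : N κ ≤ N v := hN hv'.le
    have : N v ≤ N 1 := hN hv
    have : v ≤ y → N y ≤ N v := fun h => hN h
    have : y ≤ v → N v ≤ N y := fun h => hN h
    simp only [insertLetter]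
    split_ifs <;> omega
  · intro v hv
    have := h4 v hv
    simp only [insertLetter]
    split_ifs <;> omega
  · intro v hv
    have := h5 v hv
    simp only [insertLetter]
    split_ifs <;> omega

theorem rotHop_top {κ : ℕ} {Y : ℕ → ℕ} {t : ℕ} (h : Y t = κ) : rotHop κ Y t = 0 := by
  simp [rotHop, hop, h, rot]

theorem rotHop_zero {κ : ℕ} (hκ : 1 ≤ κ) {Y : ℕ → ℕ} {t : ℕ} (h : Y t = 0) :
    rotHop κ Y t = if 0 < queue κ Y t then 1 else 0 := by
  have h0 : (0 : ℕ) ≠ κ := by omega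
  have h1 : κ ≠ 0 := by omega
  by_cases hq : 0 < queue κ Y t <;> simp [rotHop, hop, h, rot, h0, hq, h1]

theorem rotHop_mid {κ : ℕ} {Y : ℕ → ℕ} {t : ℕ} (h : Y t ≠ 0) (h' : Y t ≠ κ) :
    rotHop κ Y t = Y t + 1 := by
  simp [rotHop, hop, h, h', rot]

theorem rotHop_le {κ : ℕ} (hκ : 1 ≤ κ) {Y : ℕ → ℕ} (hY : ∀ x, Y x ≤ κ) (t : ℕ) :
    rotHop κ Y t ≤ κ := by
  have := hY t
  simp only [rotHop, hop, rot]
  split_ifs <;> omega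

theorem exists_linked {κ c : ℕ} (hκ : 1 ≤ κ) {Y : ℕ → ℕ} (hY : ∀ x, Y x ≤ κ) (t : ℕ) :
    ∃ m, Linked κ c (load c Y t) (load c (rotHop κ Y) t) (queue κ Y t) m := by
  induction t with
  | zero =>
    refine ⟨0, ?_, ?_, ?_, ?_, ?_⟩ <;> simp only [load, queue]
    · split_ifs <;> omega
    · split_ifs <;> omega
    · intro v hv hv'
      rw [if_neg (by omega), if_neg (by omega), if_neg (by omega)]
    · intro v hv
      split_ifs <;> omega
    · intro v hv
      split_ifs <;> omega
  | succ t ih =>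
    obtain ⟨m, h⟩ := ih
    have hN := load_antitone c Y t
    have hc := load_le c Y t
    have hN0 := load_zero_right c Y t
    have hM0 := load_zero_right c (rotHop κ Y) t
    have hYt := hY t
    simp only [load, queue]
    by_cases h1 : Y t = κ
    · rw [rotHop_top h1, h1, if_pos rfl]
      exact h.step_top hκ hN hc hM0
    · by_cases h0 : Y t = 0
      · rw [rotHop_zero hκ h0, if_neg h1, if_pos h0, h0]
        exact h.step_zero hκ hN hc hN0 hM0
      · rw [rotHop_mid h0 h1, if_neg h1, if_neg h0]
        exact h.step_mid hκ hN hc (by omega) (by omega)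

/-- By the exchange relation the two gains differ by the increment of the number of balls of color
`κ` in the carrier, so that the difference telescopes. -/
theorem gain_rotHop {κ c : ℕ} (hκ : 1 ≤ κ) {Y : ℕ → ℕ} (hY : ∀ x, Y x ≤ κ) (t : ℕ) :
    gain c Y t + load c Y t κ = gain c (rotHop κ Y) t + load c Y (t + 1) κ := by
  obtain ⟨m, h1, h2, h3, h4, h5⟩ := exists_linked (c := c) hκ hY t
  have hN := load_antitone c Y t
  have hc := load_le c Y t
  have hN0 := load_zero_right c Y t
  have hM0 := load_zero_right c (rotHop κ Y) t
  have hYt := hY t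
  have hκ1 : load c Y t κ ≤ load c Y t 1 := hN hκ
  have hκ1' : κ = 1 → load c Y t κ = load c Y t 1 := fun h => by rw [h]
  have hc1 := hc 1
  by_cases hy : Y t = κ
  · simp only [gain, load, insertLetter, rotHop_top hy, hy, le_refl, and_self, if_true]
    split_ifs <;> omega
  · by_cases h0 : Y t = 0
    · simp only [gain, load, insertLetter, rotHop_zero hκ h0, h0]
      by_cases hk : 0 < queue κ Y t <;> simp only [hk, if_true, if_false] <;>
      split_ifs <;> omega
    · have := h3 (Y t) (by omega) (by omega)
      have := hc (Y t)
      have : load c Y t κ ≤ load c Y t (Y t) := hN hYt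
      simp only [gain, load, insertLetter, rotHop_mid h0 hy]
      split_ifs <;> omega

theorem energy_rotHop {κ c : ℕ} (hκ : 1 ≤ κ) {Y : ℕ → ℕ} (hY : ∀ x, Y x ≤ κ) (T : ℕ) :
    energy c Y T = energy c (rotHop κ Y) T + load c Y T κ := by
  induction T with
  | zero =>
    have : κ ≠ 0 := by omega
    simp [energy, load, this]
  | succ T ih =>
    have := gain_rotHop (c := c) hκ hY T
    rw [energy_succ, energy_succ]
    omega

/-! ### The jump operators in terms of a queue -/

/-- The colors of a configuration as natural numbers. -/
def colors {κ : ℕ} (Y : Config κ) (x : ℕ) : ℕ := Y x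

theorem colors_le {κ : ℕ} (Y : Config κ) (x : ℕ) : colors Y x ≤ κ := Nat.lt_succ_iff.1 (Y x).2

theorem colors_eq_zero_of_le {κ : ℕ} (Y : Config κ) {x : ℕ} (hx : Y.support.sup id + 1 ≤ x) :
    colors Y x = 0 := by
  have : x ∉ Y.support := fun h => by
    have : x ≤ Y.support.sup id := Finset.le_sup (f := id) h
    omega
  rw [Finsupp.notMem_support_iff] at this
  rw [colors, this, Fin.val_zero]

theorem colors_eq_zero_iff {κ : ℕ} {Y : Config κ} {x : ℕ} : colors Y x = 0 ↔ Y x = 0 :=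
  Fin.val_eq_zero_iff

theorem colors_eq_iff {κ : ℕ} {Y : Config κ} {x : ℕ} {a : Fin (κ + 1)} :
    colors Y x = a ↔ Y x = a := by
  simp [colors, Fin.ext_iff]

/-- The number of empty boxes in `[x, y)`. -/
def numEmpty {κ : ℕ} (Y : Config κ) (x y : ℕ) : ℕ := ((Finset.Ico x y).filter fun z => Y z = 0).card

theorem numEmpty_succ_right {κ : ℕ} (Y : Config κ) {x y : ℕ} (h : x ≤ y) :
    numEmpty Y x (y + 1) = numEmpty Y x y + if Y y = 0 then 1 else 0 := by
  rw [numEmpty, ← Finset.insert_Ico_right_eq_Ico_add_one h, Finset.filter_insert]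
  split_ifs with h0
  · rw [Finset.card_insert_of_notMem (by simp)]
    rfl
  · rfl

theorem numEmpty_succ_left {κ : ℕ} (Y : Config κ) {x y : ℕ} (h : x < y) :
    numEmpty Y x y = numEmpty Y (x + 1) y + if Y x = 0 then 1 else 0 := by
  rw [numEmpty, ← Finset.insert_Ico_add_one_left_eq_Ico h, Finset.filter_insert]
  split_ifs with h0
  · rw [Finset.card_insert_of_notMem (by simp)]
    rfl
  · rfl

theorem numEmpty_mono {κ : ℕ} (Y : Config κ) (x : ℕ) : Monotone (numEmpty Y x) := fun _ _ h =>
  Finset.card_le_card (Finset.filter_subset_filter _ (Finset.Ico_subset_Ico_right h))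

theorem numEmpty_le_of_forall {κ : ℕ} (Y : Config κ) {x q e : ℕ}
    (h : ∀ y, x ≤ y → y < e → Y y = 0 → numEmpty Y x y < q) : numEmpty Y x e ≤ q := by
  induction e with
  | zero => simp [numEmpty]
  | succ e ih =>
    by_cases hx : x ≤ e
    · rw [numEmpty_succ_right Y hx]
      have := ih fun y hy hy' => h y hy (by omega)
      split_ifs with h0
      · exact h e hx (by omega) h0
      · omega
    · have : Finset.Ico x (e + 1) = ∅ := Finset.Ico_eq_empty (by omega)
      simp [numEmpty, this]

theorem nextEmpty_min {κ : ℕ} (Y : Config κ) {x y : ℕ} (h1 : x < y) (h2 : y < nextEmpty Y x) :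
    Y y ≠ 0 := fun h =>
  Nat.notMem_of_lt_sInf (s := {y | x < y ∧ Y y = 0}) h2 ⟨h1, h⟩

/-- Invariant linking sequential moves to the queue: once the balls left of `x` have moved, the part
left of `x` is final, and the balls still in the queue occupy the first empty boxes from `x` on. -/
theorem foldl_moveBall_apply {κ : ℕ} (a : Fin (κ + 1)) (ha : a ≠ 0) (Y : Config κ) (x y : ℕ) :
    (((List.range x).filter fun z => Y z = a).foldl moveBall Y) y =
      if y < x then (if Y y = a then 0 else
        if Y y = 0 ∧ 0 < queue a (colors Y) y then a else Y y)
      else if Y y = 0 ∧ numEmpty Y x y < queue a (colors Y) x then a else Y y := by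
  induction x generalizing y with
  | zero => simp [queue]
  | succ x ih =>
    rw [List.range_succ, List.filter_append, List.foldl_append]
    set Z := ((List.range x).filter fun z => Y z = a).foldl moveBall Y with hZ
    have hq : queue a (colors Y) (x + 1) = if Y x = a then queue a (colors Y) x + 1 else
        if Y x = 0 then queue a (colors Y) x - 1 else queue a (colors Y) x := by
      simp only [queue, colors_eq_iff, colors_eq_zero_iff]
    have hZx := ih x
    rw [if_neg (lt_irrefl x)] at hZx
    have hxx : numEmpty Y x x = 0 := by simp [numEmpty]
    rw [hxx] at hZx
    by_cases hxa : Y x = a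
    · have hx0 : Y x ≠ 0 := hxa ▸ ha
      rw [if_neg (fun h => hx0 h.1), hxa] at hZx
      have hl : [x].filter (fun z => decide (Y z = a)) = [x] := by simp [hxa]
      rw [hl, hq, if_pos hxa]
      simp only [List.foldl_cons, List.foldl_nil, moveBall, Finsupp.coe_update,
        Function.update_apply, hZx]
      obtain ⟨he1, he2⟩ := nextEmpty_spec Z x
      have he3 : ∀ y, x < y → y < nextEmpty Z x → Z y ≠ 0 := fun y => nextEmpty_min Z
      set e := nextEmpty Z x
      have hYe : Y e = 0 ∧ ¬ numEmpty Y x e < queue a (colors Y) x := by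
        have := ih e
        rw [he2, if_neg (by omega)] at this
        split_ifs at this with h
        · exact absurd this.symm ha
        · exact ⟨this.symm, fun h' => h ⟨this.symm, h'⟩⟩
      -- All boxes of `Y` that are empty before `e` are already filled by queued balls. With `hYe`
      -- this places exactly as many empty boxes before `e` as there are queued balls, so the new
      -- ball takes the next one.
      have hlt : ∀ y, x ≤ y → y < e → Y y = 0 → numEmpty Y x y < queue a (colors Y) x := by
        intro y hy hye hy0
        have hxy : x ≠ y := fun h => hx0 (h ▸ hy0)
        have h1 := he3 y (by omega) hye
        have h2 := ih y
        rw [if_neg (by omega)] at h2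
        by_contra hcon
        rw [if_neg (fun h => hcon h.2)] at h2
        exact h1 (h2.trans hy0)
      have hle := numEmpty_le_of_forall Y hlt
      by_cases hye : y = e
      · subst hye
        have h3 := numEmpty_succ_left Y he1
        rw [if_neg hx0] at h3
        rw [if_pos rfl, if_neg (by omega), if_pos ⟨hYe.1, by omega⟩]
      · rw [if_neg hye]
        by_cases hyx : y = x
        · subst hyx
          simp [hxa]
        · rw [if_neg hyx, ih y]
          by_cases hyx' : y < x
          · have hyx1 : y < x + 1 := by omega
            simp only [hyx', hyx1, if_true]
          · have hyx1 : ¬ y < x + 1 := by omega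
            simp only [hyx', hyx1, if_false]
            have h3 := numEmpty_succ_left Y (x := x) (y := y) (by omega)
            rw [if_neg hx0] at h3
            refine if_congr (and_congr_right fun hy0 => ?_) rfl rfl
            rcases lt_or_gt_of_ne hye with h | h
            · have := hlt y (by omega) h hy0
              omega
            · have h4 := numEmpty_mono Y x (show e + 1 ≤ y from h)
              rw [numEmpty_succ_right Y he1.le, if_pos hYe.1] at h4
              omega
    · have hl : [x].filter (fun z => decide (Y z = a)) = [] := by simp [hxa]
      rw [hl, List.foldl_nil, hq, if_neg hxa, ih y]
      by_cases hyx : y = x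
      · subst hyx
        simp only [lt_irrefl, Nat.lt_succ_self, if_true, if_false, hxa, hxx]
      · by_cases hyx' : y < x
        · have hyx1 : y < x + 1 := by omega
          simp only [hyx', hyx1, if_true]
        · have hyx1 : ¬ y < x + 1 := by omega
          simp only [hyx', hyx1, if_false]
          have h3 := numEmpty_succ_left Y (x := x) (y := y) (by omega)
          refine if_congr (and_congr_right fun hy0 => ?_) rfl rfl
          split_ifs at h3 ⊢ <;> omega

theorem sort_support_filter {κ : ℕ} {a : Fin (κ + 1)} (ha : a ≠ 0) (Y : Config κ) {T : ℕ}
    (hT : Y.support.sup id + 1 ≤ T) :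
    (Y.support.filter fun x => Y x = a).sort (· ≤ ·) =
      (List.range T).filter fun z => Y z = a := by
  have h : (Y.support.filter fun x => Y x = a) =
      ((List.range T).filter fun z => Y z = a).toFinset := by
    ext x
    simp only [Finset.mem_filter, Finsupp.mem_support_iff, List.mem_toFinset, List.mem_filter,
      List.mem_range, decide_eq_true_eq]
    constructor
    · rintro ⟨h1, h2⟩
      refine ⟨?_, h2⟩
      by_contra h3
      exact h1 (colors_eq_zero_iff.1 (colors_eq_zero_of_le Y (by omega)))
    · rintro ⟨-, h2⟩
      exact ⟨h2 ▸ ha, h2⟩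
  rw [h, List.toFinset_sort (· ≤ ·) (List.nodup_range.filter _)]
  exact (List.pairwise_le_range).filter _

theorem colors_jump {κ : ℕ} {a : Fin (κ + 1)} (ha : a ≠ 0) (Y : Config κ) :
    colors (jump a Y) = hop a (colors Y) := by
  funext y
  rw [colors, jump, sort_support_filter ha Y (le_max_left _ (y + 1)), foldl_moveBall_apply a ha,
    if_pos (lt_of_lt_of_le (Nat.lt_succ_self y) (le_max_right _ _))]
  simp only [hop, colors_eq_iff, colors_eq_zero_iff]
  split_ifs <;> simp [colors]

/-! ### The time evolution -/

/-- The configuration after the balls of the colors greater than `a` have jumped. -/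
noncomputable def stage {κ : ℕ} (Y : Config κ) (a : ℕ) : Config κ :=
  ((List.finRange κ).drop a).foldr (fun i Z => jump i.succ Z) Y

theorem stage_zero {κ : ℕ} (Y : Config κ) : stage Y 0 = evolve Y := rfl

theorem stage_top {κ : ℕ} (Y : Config κ) : stage Y κ = Y := by
  rw [stage, List.drop_of_length_le (by simp), List.foldr_nil]

theorem colors_stage {κ : ℕ} (Y : Config κ) {a : ℕ} (ha : a < κ) :
    colors (stage Y a) = hop (a + 1) (colors (stage Y (a + 1))) := by
  have : (List.finRange κ).drop a = ⟨a, ha⟩ :: (List.finRange κ).drop (a + 1) := by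
    rw [List.drop_eq_getElem_cons (by simpa using ha)]
    simp
  rw [stage, this, List.foldr_cons, colors_jump (Fin.succ_ne_zero _)]
  rfl

/-- The letter which the carrier with infinite capacity and threshold counts `N` releases when it
meets the letter `y`. -/
def released (κ : ℕ) (N : ℕ → ℕ) (y : ℕ) : ℕ :=
  Nat.findGreatest (fun v => (if y = 0 then 0 else N y) < N v) κ

theorem le_released_iff {κ : ℕ} {N : ℕ → ℕ} (hN : Antitone N) (hN0 : ∀ v, κ < v → N v = 0)
    {y v : ℕ} (hv : v ≠ 0) :
    v ≤ released κ N y ↔ (if y = 0 then 0 else N y) < N v := by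
  constructor
  · intro h
    have h0 : released κ N y ≠ 0 := by omega
    exact (Nat.findGreatest_of_ne_zero rfl h0).trans_le (hN h)
  · intro h
    refine Nat.le_findGreatest ?_ h
    by_contra hvκ
    have := hN0 v (by omega)
    omega

theorem pile_eq_zero {κ : ℕ} {Y : ℕ → ℕ} (hY : ∀ x, Y x ≤ κ) (t : ℕ) {v : ℕ} (hv : κ < v) :
    pile Y t v = 0 := by
  induction t with
  | zero => rfl
  | succ t ih =>
    have := hY t
    simp only [pile, pushLetter]
    split_ifs <;> omega

/-- Interpolates between `Y` at `a = κ` and the carrier output at `a = 0`: colors up to `a` have not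
moved, and only released letters above `a` are in place. -/
theorem colors_stage_eq {κ : ℕ} (Y : Config κ) {a : ℕ} (ha : a ≤ κ) (x : ℕ) :
    colors (stage Y a) x = if colors Y x ≠ 0 ∧ colors Y x ≤ a then colors Y x else
      if a < released κ (pile (colors Y) x) (colors Y x) then
        released κ (pile (colors Y) x) (colors Y x) else 0 := by
  induction ha using Nat.decreasingInduction generalizing x with
  | self =>
    rw [stage_top]
    have h1 := colors_le Y x
    have h2 : ¬ κ < released κ (pile (colors Y) x) (colors Y x) :=
      not_lt.2 (Nat.findGreatest_le κ)
    split_ifs <;> omega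
  | of_succ a ha ih =>
    have hrel : ∀ z v, v ≠ 0 → (v ≤ released κ (pile (colors Y) z) (colors Y z) ↔
        (if colors Y z = 0 then 0 else pile (colors Y) z (colors Y z)) < pile (colors Y) z v) :=
      fun z v hv => le_released_iff (pile_antitone _ z) (fun v => pile_eq_zero (colors_le Y) z) hv
    have hmono : ∀ z, pile (colors Y) z (a + 2) ≤ pile (colors Y) z (a + 1) := fun z =>
      pile_antitone (colors Y) z (by omega)
    have hlow : ∀ z, colors Y z ≤ a + 1 →
        pile (colors Y) z (a + 1) ≤ pile (colors Y) z (colors Y z) := fun z h =>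
      pile_antitone (colors Y) z h
    have hhigh : ∀ z, a + 2 ≤ colors Y z →
        pile (colors Y) z (colors Y z) ≤ pile (colors Y) z (a + 2) := fun z h =>
      pile_antitone (colors Y) z h
    have heq : ∀ z, colors Y z = a + 1 →
        pile (colors Y) z (colors Y z) = pile (colors Y) z (a + 1) := fun z h => by rw [h]
    -- The jump queue for the color `a + 1` is precisely the set of balls of that color in the
    -- infinite capacity carrier.
    have hq : ∀ z, queue (a + 1) (colors (stage Y (a + 1))) z =
        pile (colors Y) z (a + 1) - pile (colors Y) z (a + 2) := by
      intro z
      induction z with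
      | zero => rfl
      | succ z ihz =>
        have h1 := ih z
        have h2 := hmono z
        have h3 := hlow z
        have h4 := hhigh z
        have h5 := heq z
        have h6 := hrel z (a + 1) (by omega)
        have h7 := hrel z (a + 2) (by omega)
        simp only [queue, ihz, h1, pile, pushLetter]
        generalize released κ (pile (colors Y) z) (colors Y z) = r at *
        generalize pile (colors Y) z (colors Y z) = Ny at *
        generalize pile (colors Y) z (a + 1) = N1 at *
        generalize pile (colors Y) z (a + 2) = N2 at *
        generalize colors Y z = y at *
        clear hrel hmono hlow hhigh heq ih ihz h1
        split_ifs at * <;> omega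
    have h2 := hmono x
    have h3 := hlow x
    have h4 := hhigh x
    have h5 := heq x
    have h6 := hrel x (a + 1) (by omega)
    have h7 := hrel x (a + 2) (by omega)
    rw [colors_stage Y ha]
    simp only [hop, hq, ih]
    generalize released κ (pile (colors Y) x) (colors Y x) = r at *
    generalize pile (colors Y) x (colors Y x) = Ny at *
    generalize pile (colors Y) x (a + 1) = N1 at *
    generalize pile (colors Y) x (a + 2) = N2 at *
    generalize colors Y x = y at *
    clear hrel hmono hlow hhigh heq ih hq
    split_ifs at * <;> omega

theorem colors_evolve {κ : ℕ} (Y : Config κ) (x : ℕ) :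
    colors (evolve Y) x = released κ (pile (colors Y) x) (colors Y x) := by
  rw [← stage_zero, colors_stage_eq Y (Nat.zero_le κ) x]
  split_ifs <;> omega

theorem le_colors_evolve_iff {κ : ℕ} (Y : Config κ) {x v : ℕ} (hv : v ≠ 0) :
    v ≤ colors (evolve Y) x ↔
      (if colors Y x = 0 then 0 else pile (colors Y) x (colors Y x)) < pile (colors Y) x v := by
  rw [colors_evolve]
  exact le_released_iff (pile_antitone _ x) (fun v => pile_eq_zero (colors_le Y) x) hv

/-! ### Conservation of the energies -/

theorem rot_injOn {κ : ℕ} : Set.InjOn (rot κ) (Set.Iic κ) := by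
  intro a ha b hb h
  simp only [Set.mem_Iic, rot] at *
  split_ifs at h <;> omega

theorem rot_mapsTo {κ : ℕ} : Set.MapsTo (rot κ) (Set.Iic κ) (Set.Iic κ) := by
  intro a ha
  simp only [Set.mem_Iic, rot] at *
  split_ifs <;> omega

theorem rot_iterate_add {κ a j : ℕ} (ha : a ≠ 0) (h : a + j ≤ κ) : (rot κ)^[j] a = a + j := by
  induction j with
  | zero => rfl
  | succ j ih =>
    rw [Function.iterate_succ_apply', ih (by omega), rot, if_neg (by omega), if_neg (by omega)]
    omega

theorem rot_iterate_self {κ a : ℕ} (h : a ≤ κ) : (rot κ)^[κ] a = a := by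
  by_cases ha : a = 0
  · subst ha
    exact Function.iterate_fixed (by simp [rot]) κ
  -- The orbit climbs from `a` to `κ`, wraps around to `1`, and climbs back to `a`.
  · have h1 : κ = (a - 1) + (1 + (κ - a)) := by omega
    nth_rw 2 [h1]
    rw [Function.iterate_add_apply, Function.iterate_add_apply, rot_iterate_add ha (by omega),
      Function.iterate_one, show a + (κ - a) = κ by omega, rot, if_neg (by omega), if_pos rfl,
      rot_iterate_add one_ne_zero (by omega)]
    omega

theorem rot_iterate_zero (κ j : ℕ) : (rot κ)^[j] 0 = 0 := Function.iterate_fixed (by simp [rot]) j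

/-- Jumps commute with renaming the positive colors. -/
theorem hop_comp {s : Set ℕ} {f : ℕ → ℕ} (hf : Set.InjOn f s) (hs : 0 ∈ s) (hf0 : f 0 = 0) {a : ℕ}
    (ha : a ∈ s) {Y : ℕ → ℕ} (hY : ∀ x, Y x ∈ s) : hop (f a) (f ∘ Y) = f ∘ hop a Y := by
  have h1 : ∀ x, f (Y x) = f a ↔ Y x = a := fun x => hf.eq_iff (hY x) ha
  have h2 : ∀ x, f (Y x) = 0 ↔ Y x = 0 := fun x => by
    rw [← hf.eq_iff (hY x) hs, hf0]
  have hq : ∀ t, queue (f a) (f ∘ Y) t = queue a Y t := by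
    intro t
    induction t with
    | zero => rfl
    | succ t ih => simp only [queue, Function.comp_apply, h1, h2, ih]
  funext x
  simp only [hop, Function.comp_apply, h1, h2, hq]
  split_ifs <;> simp [hf0]

theorem iterate_rotHop {κ : ℕ} (Y : Config κ) {a : ℕ} (ha : a ≤ κ) :
    (rotHop κ)^[κ - a] (colors Y) = (rot κ)^[κ - a] ∘ colors (stage Y a) := by
  induction ha using Nat.decreasingInduction with
  | self => simp [stage_top]
  | of_succ a ha ih =>
    have h1 : κ - a = (κ - (a + 1)) + 1 := by omega
    rw [h1, Function.iterate_succ_apply', ih, colors_stage Y ha]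
    have h2 : (rot κ)^[κ - (a + 1)] (a + 1) = κ := by
      rw [rot_iterate_add (by omega) (by omega)]
      omega
    have h3 := hop_comp (rot_injOn.iterate (rot_mapsTo (κ := κ)) (κ - (a + 1)))
      (Set.mem_Iic.2 (Nat.zero_le κ)) (rot_iterate_zero κ _) (Set.mem_Iic.2 ha)
      (fun x => Set.mem_Iic.2 (colors_le (stage Y (a + 1)) x))
    rw [h2] at h3
    funext x
    rw [rotHop, h3, Function.comp_apply, Function.comp_apply, Function.iterate_succ_apply']

theorem iterate_rotHop_self {κ : ℕ} (Y : Config κ) :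
    (rotHop κ)^[κ] (colors Y) = colors (evolve Y) := by
  have := iterate_rotHop Y (Nat.zero_le κ)
  rw [Nat.sub_zero] at this
  rw [this]
  funext x
  exact rot_iterate_self (colors_le _ x)

theorem rotHop_eventually_zero {κ : ℕ} {Y : ℕ → ℕ} (h : ∀ᶠ x in atTop, Y x = 0) :
    ∀ᶠ x in atTop, rotHop κ Y x = 0 := by
  obtain ⟨T, hT⟩ := eventually_atTop.1 h
  have hq : ∀ k, queue κ Y (T + k) ≤ queue κ Y T - k ∨ κ = 0 := by
    intro k
    induction k with
    | zero => simp
    | succ k ih =>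
      have h0 := hT (T + k) (by omega)
      rw [← add_assoc, queue, h0]
      split_ifs <;> omega
  refine eventually_atTop.2 ⟨T + queue κ Y T, fun x hx => ?_⟩
  have h0 := hT x (by omega)
  have := hq (x - T)
  rw [show T + (x - T) = x by omega] at this
  simp only [rotHop, hop, h0, rot]
  split_ifs <;> omega

theorem colors_eventually_zero {κ : ℕ} (Y : Config κ) : ∀ᶠ x in atTop, colors Y x = 0 :=
  eventually_atTop.2 ⟨_, fun _ => colors_eq_zero_of_le Y⟩

theorem energy_iterate_rotHop {κ c : ℕ} (hκ : 1 ≤ κ) {Y : ℕ → ℕ} (hY : ∀ x, Y x ≤ κ)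
    (h : ∀ᶠ x in atTop, Y x = 0) (j : ℕ) :
    ∀ᶠ T in atTop, energy c ((rotHop κ)^[j] Y) T = energy c Y T := by
  induction j generalizing Y with
  | zero => simp
  | succ j ih =>
    filter_upwards [ih (rotHop_le hκ hY) (rotHop_eventually_zero h),
      -- Waiting `c` more boxes after the last ball empties the carrier, which removes the
      -- correction term of `energy_rotHop`.
      (tendsto_atTop_atTop.2 fun b => ⟨b + c, fun a ha => (by omega : b ≤ a - c)⟩ :
        Tendsto (fun T : ℕ => T - c) atTop atTop).eventually
          (eventually_ge_atTop (eventually_atTop.1 h).choose), eventually_ge_atTop c]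
      with T hT hT' hTc
    rw [Function.iterate_succ_apply, hT, energy_rotHop hκ hY T,
      load_eq_zero_of_zero c (eventually_atTop.1 h).choose_spec (by omega) (by omega), add_zero]

/-- The energies are conserved by the time evolution. -/
theorem energy_evolve {κ : ℕ} (hκ : 1 ≤ κ) (c : ℕ) (Y : Config κ) :
    ∀ᶠ T in atTop, energy c (colors (evolve Y)) T = energy c (colors Y) T := by
  rw [← iterate_rotHop_self]
  exact energy_iterate_rotHop hκ (colors_le Y) (colors_eventually_zero Y) κ

theorem energy_evolve_iterate {κ : ℕ} (hκ : 1 ≤ κ) (c : ℕ) (Y : Config κ) (t : ℕ) :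
    ∀ᶠ T in atTop, energy c (colors (evolve^[t] Y)) T = energy c (colors Y) T := by
  induction t with
  | zero => simp
  | succ t ih =>
    filter_upwards [ih, energy_evolve hκ c (evolve^[t] Y)] with T h1 h2
    rw [Function.iterate_succ_apply', h2, h1]

/-! ### Runs of balls by position -/

/-- The letter before the position `x`, and `0` for `x = 0`. -/
def prevLetter (Y : ℕ → ℕ) : ℕ → ℕ
  | 0 => 0
  | x + 1 => Y x

/-- The number of runs of balls that start in `[0, x)`. -/
def numRuns (Y : ℕ → ℕ) : ℕ → ℕ
  | 0 => 0
  | x + 1 => numRuns Y x + if prevLetter Y x < Y x then 1 else 0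

/-- The number of letters in `[0, x)` that are at least `v`. -/
def numGe (Y : ℕ → ℕ) (v : ℕ) : ℕ → ℕ
  | 0 => 0
  | x + 1 => numGe Y v x + if v ≤ Y x then 1 else 0

/-- The number of letters in `[0, x)` that are at least `v` and lie in the first `i` runs. -/
def numGeRuns (Y : ℕ → ℕ) (i v : ℕ) : ℕ → ℕ
  | 0 => 0
  | x + 1 => numGeRuns Y i v x + if v ≤ Y x ∧ numRuns Y (x + 1) ≤ i then 1 else 0

theorem numRuns_mono (Y : ℕ → ℕ) : Monotone (numRuns Y) :=
  monotone_nat_of_le_succ fun x => by simp [numRuns]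

theorem numGeRuns_mono (Y : ℕ → ℕ) (i v : ℕ) : Monotone (numGeRuns Y i v) :=
  monotone_nat_of_le_succ fun x => by simp [numGeRuns]

theorem numGeRuns_eq (Y : ℕ → ℕ) {i v x : ℕ} (h : numRuns Y x ≤ i) :
    numGeRuns Y i v x = numGe Y v x := by
  induction x with
  | zero => rfl
  | succ x ih =>
    have := numRuns_mono Y (Nat.le_succ x)
    simp only [numGeRuns, numGe, ih (this.trans h), h, and_true]

theorem numGeRuns_le (Y : ℕ → ℕ) (i v x : ℕ) : numGeRuns Y i v x ≤ numGe Y v x := by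
  induction x with
  | zero => exact le_rfl
  | succ x ih =>
    simp only [numGeRuns, numGe]
    split_ifs <;> omega

theorem numGeRuns_succ_of_lt (Y : ℕ → ℕ) {i v x : ℕ} (h : i < numRuns Y (x + 1)) :
    numGeRuns Y i v (x + 1) = numGeRuns Y i v x := by
  rw [numGeRuns, if_neg (by omega), add_zero]

theorem numRuns_pos (Y : ℕ → ℕ) {x : ℕ} (h : prevLetter Y x ≠ 0) : 0 < numRuns Y x := by
  induction x with
  | zero => exact absurd rfl h
  | succ x ih =>
    simp only [prevLetter] at h
    simp only [numRuns]
    split_ifs with h1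
    · omega
    · have := ih (by omega)
      omega

/-- Within the current run all letters are at least as large as the last one. -/
theorem numGe_current (Y : ℕ → ℕ) {x v : ℕ} (hv : v ≠ 0) (hv' : v ≤ prevLetter Y x) :
    numGe Y v x + numGeRuns Y (numRuns Y x - 1) 1 x =
      numGe Y 1 x + numGeRuns Y (numRuns Y x - 1) v x := by
  induction x generalizing v with
  | zero => simp [numGe, numGeRuns]
  | succ x ih =>
    simp only [prevLetter] at hv'
    by_cases h : prevLetter Y x < Y x
    · have h1 : numRuns Y (x + 1) = numRuns Y x + 1 := by simp [numRuns, h]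
      rw [numGeRuns_succ_of_lt Y (by omega), numGeRuns_succ_of_lt Y (by omega), h1,
        numGeRuns_eq Y (by omega), numGeRuns_eq Y (by omega)]
      simp only [numGe]
      split_ifs <;> omega
    · have h1 : numRuns Y (x + 1) = numRuns Y x := by simp [numRuns, h]
      have h2 := numRuns_pos Y (x := x) (by omega)
      have h3 := ih hv (by omega)
      rw [numGeRuns_succ_of_lt Y (by omega), numGeRuns_succ_of_lt Y (by omega), h1]
      simp only [numGe]
      split_ifs <;> omega

/-- The letters of the current run which are at least `v`, and some others, are in the carrier. -/
theorem numGe_le_add_pile (Y : ℕ → ℕ) {x v : ℕ} (hv : v ≠ 0) (hx : prevLetter Y x ≠ 0) :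
    numGe Y v x ≤ numGeRuns Y (numRuns Y x - 1) v x + pile Y x v := by
  induction x generalizing v with
  | zero => simp [numGe]
  | succ x ih =>
    simp only [prevLetter] at hx
    have hp : v ≤ Y x → pile Y x (Y x) ≤ pile Y x v := fun h => pile_antitone Y x h
    by_cases h : prevLetter Y x < Y x
    · have h1 : numRuns Y (x + 1) = numRuns Y x + 1 := by simp [numRuns, h]
      rw [numGeRuns_succ_of_lt Y (by omega), h1, numGeRuns_eq Y (by omega)]
      simp only [numGe, pile, pushLetter]
      split_ifs <;> omega
    · have h1 : numRuns Y (x + 1) = numRuns Y x := by simp [numRuns, h]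
      have h2 := numRuns_pos Y (x := x) (by omega)
      have h3 := ih hv (by omega)
      -- The bound is needed at threshold `Y x` too: if the new ball does not raise the count at
      -- `v`, that count already exceeds the one at `Y x`, hence the number of balls in the current
      -- run so far.
      have h4 := ih hx (by omega)
      have h5 := numGe_current Y (x := x) hx (by omega)
      have h6 : v ≤ Y x → _ := fun h' => numGe_current Y (x := x) hv (by omega)
      rw [numGeRuns_succ_of_lt Y (by omega), h1]
      simp only [numGe, pile, pushLetter]
      split_ifs <;> omega

/-! ### The runs after one step of the time evolution -/

/-- `Z` consists of the letters that the carrier with infinite capacity releases over `Y`. -/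
def IsOutput (Y Z : ℕ → ℕ) : Prop :=
  ∀ x v, v ≠ 0 → (v ≤ Z x ↔ (if Y x = 0 then 0 else pile Y x (Y x)) < pile Y x v)

theorem isOutput_evolve {κ : ℕ} (Y : Config κ) : IsOutput (colors Y) (colors (evolve Y)) :=
  fun _ _ hv => le_colors_evolve_iff Y hv

theorem IsOutput.numGe_add_pile {Y Z : ℕ → ℕ} (h : IsOutput Y Z) {v : ℕ} (hv : v ≠ 0) (x : ℕ) :
    numGe Z v x + pile Y x v = numGe Y v x := by
  induction x with
  | zero => rfl
  | succ x ih =>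
    have h1 := h x v hv
    have hp : v ≤ Y x → pile Y x (Y x) ≤ pile Y x v := fun h => pile_antitone Y x h
    have hp' : Y x ≤ v → pile Y x v ≤ pile Y x (Y x) := fun h => pile_antitone Y x h
    simp only [numGe, pile, pushLetter]
    split_ifs at * <;> omega

/-- The released letter was the largest replaceable one. So while the input run continues, or boxes
stay empty, the output cannot increase. When a run ends, its last ball is itself replaceable and
exceeds the previous output, which forces an ascent. The extra conjuncts record this state of the
carrier. -/
theorem IsOutput.numRuns_aux {Y Z : ℕ → ℕ} (h : IsOutput Y Z) (x : ℕ) :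
    numRuns Z x + (if prevLetter Y x ≠ 0 then 1 else 0) = numRuns Y x ∧
    (prevLetter Y x ≠ 0 → prevLetter Z x < prevLetter Y x ∧ 0 < pile Y x (prevLetter Y x) ∧
      (∀ v, prevLetter Y x < v → pile Y x v < pile Y x (prevLetter Y x)) ∧
      ∀ v, v ≠ 0 → pile Y x (prevLetter Y x) < pile Y x v → v ≤ prevLetter Z x) ∧
    (prevLetter Y x = 0 → ∀ v, v ≠ 0 → 0 < pile Y x v → v ≤ prevLetter Z x) := by
  induction x with
  | zero => simp [numRuns, prevLetter, pile]
  | succ x ih =>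
    obtain ⟨ih1, ih2, ih3⟩ := ih
    refine ⟨?_, ?_, ?_⟩
    · have key := h x (prevLetter Z x + 1) (by omega)
      have key2 := h x (prevLetter Y x)
      have hlt : prevLetter Z x + 1 ≤ Z x ↔ prevLetter Z x < Z x := Iff.rfl
      rw [hlt] at key
      show numRuns Z x + (if prevLetter Z x < Z x then 1 else 0) + (if Y x ≠ 0 then 1 else 0) =
        numRuns Y x + if prevLetter Y x < Y x then 1 else 0
      by_cases h0 : prevLetter Y x = 0
      · have h4 := ih3 h0 (prevLetter Z x + 1) (by omega)
        rw [if_neg (by simpa using h0)] at ih1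
        have h5 : ¬ prevLetter Z x < Z x := by
          rw [key]
          split_ifs <;> omega
        rw [if_neg h5, h0]
        split_ifs <;> omega
      · obtain ⟨h4, h5, h6, h7⟩ := ih2 h0
        have h8 := h7 (prevLetter Z x + 1) (by omega)
        rw [if_pos h0] at ih1
        by_cases hy : Y x = 0
        · have h9 : prevLetter Y x ≤ Z x := (key2 h0).2 (by simpa [hy] using h5)
          split_ifs <;> omega
        · rw [if_neg hy] at key key2
          by_cases hy2 : Y x ≤ prevLetter Y x
          · have h9 : pile Y x (prevLetter Y x) ≤ pile Y x (Y x) := pile_antitone Y x hy2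
            have h10 : ¬ prevLetter Z x < Z x := by
              rw [key]
              omega
            split_ifs <;> omega
          · have h9 := (key2 h0).2 (h6 _ (by omega))
            split_ifs <;> omega
    · intro hy
      simp only [prevLetter] at hy ⊢
      have key := h x (Y x) hy
      rw [if_neg hy] at key
      refine ⟨by omega, ?_, fun v hv => ?_, fun v hv hv' => ?_⟩
      · simp [pile, pushLetter, hy]
      · have h1 : pile Y x v ≤ pile Y x (Y x) := pile_antitone Y x hv.le
        simp only [pile, pushLetter, hy, if_false, le_refl, and_self, if_true]
        split_ifs <;> omega
      · have h1 := h x v hv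
        rw [if_neg hy] at h1
        rw [h1]
        have h2 : Y x < v → pile Y x v ≤ pile Y x (Y x) := fun h => pile_antitone Y x h.le
        simp only [pile, pushLetter, hy, if_false, le_refl, and_self, if_true] at hv'
        split_ifs at hv' <;> omega
    · intro hy v hv hv'
      simp only [prevLetter] at hy ⊢
      rw [h x v hv, if_pos hy]
      simp only [pile, pushLetter, hy, if_true] at hv'
      omega

/-- In the output, a run starts right after the end of each run of the input, and nowhere else. -/
theorem IsOutput.numRuns_add {Y Z : ℕ → ℕ} (h : IsOutput Y Z) (x : ℕ) :
    numRuns Z x + (if prevLetter Y x ≠ 0 then 1 else 0) = numRuns Y x :=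
  (h.numRuns_aux x).1

/-- The output is still in its first `i` runs while the input passes through its next run. The balls
of that run are then matched by balls in the carrier, so at most the content of the first `i` input
runs has been released. -/
theorem IsOutput.numGeRuns_le {Y Z : ℕ → ℕ} (h : IsOutput Y Z) (i : ℕ) {v : ℕ} (hv : v ≠ 0)
    (x : ℕ) : numGeRuns Z i v x ≤ numGeRuns Y i v x := by
  have h1 := h.numRuns_add x
  have h2 := h.numGe_add_pile hv x
  by_cases hi : numRuns Y x ≤ i
  · rw [numGeRuns_eq Y hi]
    have := BoxBall.numGeRuns_le Z i v x
    omega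
  · by_cases hi' : numRuns Z x ≤ i
    · rw [numGeRuns_eq Z hi']
      by_cases h0 : prevLetter Y x = 0
      · simp only [h0, ne_eq, not_true, if_false] at h1
        omega
      · have h3 := numGe_le_add_pile Y hv h0
        rw [if_pos h0] at h1
        have h4 : numRuns Y x - 1 = i := by omega
        rw [h4] at h3
        omega
    -- Once the output is past its first `i` runs, its count is frozen while that of the input can
    -- only grow, so the claim goes back to smaller positions.
    · induction x with
      | zero => exact le_rfl
      | succ x ih =>
        rw [numGeRuns_succ_of_lt Z (by omega)]
        refine le_trans ?_ (numGeRuns_mono Y i v (Nat.le_succ x))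
        have h1' := h.numRuns_add x
        have h2' := h.numGe_add_pile hv x
        by_cases hi1 : numRuns Y x ≤ i
        · rw [numGeRuns_eq Y hi1]
          have := BoxBall.numGeRuns_le Z i v x
          omega
        · by_cases hi2 : numRuns Z x ≤ i
          · rw [numGeRuns_eq Z hi2]
            by_cases h0 : prevLetter Y x = 0
            · simp only [h0, ne_eq, not_true, if_false] at h1'
              omega
            · have h3 := numGe_le_add_pile Y hv h0
              rw [if_pos h0] at h1'
              have h4 : numRuns Y x - 1 = i := by omega
              rw [h4] at h3
              omega
          · exact ih h1' h2' hi1 hi2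

/-! ### The list of runs -/

/-- The part of the run with index `i` that lies in `[0, x)`. -/
def runWord {κ : ℕ} (Y : Config κ) (i x : ℕ) : List (Fin (κ + 1)) :=
  ((List.range x).filter fun t => decide (Y t ≠ 0 ∧ numRuns (colors Y) (t + 1) = i + 1)).map Y

theorem runWord_succ {κ : ℕ} (Y : Config κ) (i x : ℕ) :
    runWord Y i (x + 1) =
      runWord Y i x ++ if Y x ≠ 0 ∧ numRuns (colors Y) (x + 1) = i + 1 then [Y x] else [] := by
  rw [runWord, List.range_succ, List.filter_append, List.map_append]
  congr 1
  split_ifs with h <;> simp [h]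

theorem runWord_succ_of_ne {κ : ℕ} {Y : Config κ} {i x : ℕ}
    (h : numRuns (colors Y) (x + 1) ≠ i + 1) : runWord Y i (x + 1) = runWord Y i x := by
  rw [runWord_succ, if_neg (fun h' => h h'.2), List.append_nil]

theorem runWord_eq_nil {κ : ℕ} {Y : Config κ} {i x : ℕ} (h : numRuns (colors Y) x ≤ i) :
    runWord Y i x = [] := by
  induction x with
  | zero => rfl
  | succ x ih =>
    have := numRuns_mono (colors Y) (Nat.le_succ x)
    rw [runWord_succ_of_ne (by omega), ih (this.trans h)]

theorem ne_zero_of_mem_runWord {κ : ℕ} {Y : Config κ} {i x : ℕ} {a : Fin (κ + 1)}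
    (h : a ∈ runWord Y i x) : a ≠ 0 := by
  simp only [runWord, List.mem_map, List.mem_filter, decide_eq_true_eq] at h
  obtain ⟨t, ⟨-, ht, -⟩, rfl⟩ := h
  exact ht

theorem runWord_sorted_aux {κ : ℕ} (Y : Config κ) (i x : ℕ) :
    (runWord Y i x).Pairwise (· ≥ ·) ∧
      (prevLetter (colors Y) x ≠ 0 → numRuns (colors Y) x = i + 1 →
        ∀ a ∈ runWord Y i x, prevLetter (colors Y) x ≤ a) := by
  induction x with
  | zero => simp [runWord]
  | succ x ih =>
    obtain ⟨ih1, ih2⟩ := ih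
    have h0 : prevLetter (colors Y) (x + 1) = colors Y x := rfl
    by_cases h : Y x ≠ 0 ∧ numRuns (colors Y) (x + 1) = i + 1
    · have hpos : colors Y x ≠ 0 := fun h' => h.1 (colors_eq_zero_iff.1 h')
      have key : ∀ a ∈ runWord Y i x, colors Y x ≤ a := by
        by_cases hlt : prevLetter (colors Y) x < colors Y x
        · have h1 : numRuns (colors Y) x ≤ i := by
            have := h.2
            simp only [numRuns, if_pos hlt] at this
            omega
          simp [runWord_eq_nil h1]
        · intro a ha
          have h1 : numRuns (colors Y) x = i + 1 := by
            have := h.2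
            simp only [numRuns, if_neg hlt] at this
            omega
          exact (not_lt.1 hlt).trans (ih2 (by omega) h1 a ha)
      rw [runWord_succ, if_pos h]
      refine ⟨List.pairwise_append.2 ⟨ih1, List.pairwise_singleton _ _, fun a ha b hb => ?_⟩,
        fun _ _ a ha => ?_⟩
      · rw [List.mem_singleton.1 hb]
        exact key a ha
      · rcases List.mem_append.1 ha with ha | ha
        · exact key a ha
        · rw [List.mem_singleton.1 ha]
          exact le_rfl
    · rw [runWord_succ, if_neg h, List.append_nil]
      refine ⟨ih1, fun h1 h2 => absurd ⟨fun h' => h1 ?_, h2⟩ h⟩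
      rw [h0, colors_eq_zero_iff, h']

theorem runWord_sorted {κ : ℕ} (Y : Config κ) (i x : ℕ) : (runWord Y i x).Pairwise (· ≥ ·) :=
  (runWord_sorted_aux Y i x).1

theorem countP_runWord {κ : ℕ} (Y : Config κ) (i x : ℕ) {v : ℕ} (hv : v ≠ 0) :
    (runWord Y i x).countP (fun a : Fin (κ + 1) => decide (v ≤ (a : ℕ))) +
      numGeRuns (colors Y) i v x =
      numGeRuns (colors Y) (i + 1) v x := by
  induction x with
  | zero => rfl
  | succ x ih =>
    rw [runWord_succ, List.countP_append]
    simp only [numGeRuns]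
    have h0 : v ≤ colors Y x → Y x ≠ 0 := fun h h' => by
      rw [colors_eq_zero_iff.2 h'] at h
      omega
    have h1 : ((Y x : Fin (κ + 1)) : ℕ) = colors Y x := rfl
    by_cases h2 : v ≤ colors Y x
    · have := h0 h2
      by_cases h3 : numRuns (colors Y) (x + 1) = i + 1
      · simp only [this, h3, h2, h1, List.countP_singleton, ne_eq, not_false_eq_true, and_self,
          if_true, decide_true, le_refl, true_and]
        split_ifs <;> omega
      · simp only [h3, h2, and_false, if_false, List.countP_nil, true_and]
        split_ifs <;> omega
    · have : (if Y x ≠ 0 ∧ numRuns (colors Y) (x + 1) = i + 1 then [Y x] else []).countP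
          (fun a : Fin (κ + 1) => decide (v ≤ (a : ℕ))) = 0 := by
        split_ifs <;> simp [h1, h2]
      simp only [this, h2, false_and, if_false]
      omega

theorem length_runWord {κ : ℕ} (Y : Config κ) (i x : ℕ) :
    (runWord Y i x).length + numGeRuns (colors Y) i 1 x = numGeRuns (colors Y) (i + 1) 1 x := by
  rw [← countP_runWord Y i x one_ne_zero]
  congr 1
  refine (List.countP_eq_length.2 fun a ha => ?_).symm
  have := ne_zero_of_mem_runWord ha
  rw [← Fin.val_ne_zero_iff] at this
  simp
  omega

/-- The relation that holds between consecutive balls of a run. -/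
def runRel {κ : ℕ} (a b : Fin (κ + 1)) : Bool := decide (0 < b ∧ b ≤ a)

theorem isChain_runWord {κ : ℕ} (Y : Config κ) (i x : ℕ) :
    (runWord Y i x).IsChain fun a b => runRel a b = true := by
  refine List.Pairwise.isChain ?_
  refine (runWord_sorted Y i x).imp_of_mem fun _ hb hab => ?_
  exact decide_eq_true ⟨Fin.pos_of_ne_zero (ne_zero_of_mem_runWord hb), hab⟩

theorem getLast?_map_range {κ : ℕ} (Y : Config κ) {x : ℕ} {a : Fin (κ + 1)}
    (ha : a ∈ ((List.range x).map Y).getLast?) : (a : ℕ) = prevLetter (colors Y) x := by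
  cases x with
  | zero => simp at ha
  | succ x =>
    rw [List.range_succ, List.map_append] at ha
    simp at ha
    rw [← ha]
    rfl

/-- The second conjunct peels off the unfinished last run, so that the next ball can be appended to
it. Empty boxes split into singletons `[0]`, because `runRel` requires a positive second letter. -/
theorem splitBy_prefix {κ : ℕ} (Y : Config κ) (x : ℕ) :
    ((((List.range x).map Y).splitBy runRel).filter fun w => decide (w ≠ [0])) =
      (List.range (numRuns (colors Y) x)).map (fun i => runWord Y i x) ∧
    (prevLetter (colors Y) x ≠ 0 → ∃ l, (List.range x).map Y =
        l ++ runWord Y (numRuns (colors Y) x - 1) x ∧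
      runWord Y (numRuns (colors Y) x - 1) x ≠ [] ∧
      (∀ a ∈ l.getLast?, ∀ b ∈ (runWord Y (numRuns (colors Y) x - 1) x).head?,
        runRel a b = false) ∧
      ((l.splitBy runRel).filter fun w => decide (w ≠ [0])) =
        (List.range (numRuns (colors Y) x - 1)).map fun i => runWord Y i x) := by
  have suff : ∀ x, prevLetter (colors Y) x ≠ 0 → (∃ l, (List.range x).map Y =
        l ++ runWord Y (numRuns (colors Y) x - 1) x ∧
      runWord Y (numRuns (colors Y) x - 1) x ≠ [] ∧
      (∀ a ∈ l.getLast?, ∀ b ∈ (runWord Y (numRuns (colors Y) x - 1) x).head?,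
        runRel a b = false) ∧
      ((l.splitBy runRel).filter fun w => decide (w ≠ [0])) =
        (List.range (numRuns (colors Y) x - 1)).map fun i => runWord Y i x) →
      ((((List.range x).map Y).splitBy runRel).filter fun w => decide (w ≠ [0])) =
        (List.range (numRuns (colors Y) x)).map (fun i => runWord Y i x) := by
    rintro x hx ⟨l, h1, h2, h3, h4⟩
    have hpos := numRuns_pos (colors Y) hx
    obtain ⟨r, hr⟩ : ∃ r, numRuns (colors Y) x = r + 1 := ⟨_, (Nat.succ_pred hpos.ne').symm⟩
    rw [hr, Nat.add_sub_cancel] at h1 h2 h3 h4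
    rw [h1, List.splitBy_append h3, List.splitBy_of_isChain h2 (isChain_runWord Y _ x),
      List.filter_append, h4, hr, List.range_succ, List.map_append]
    congr 1
    have : runWord Y r x ≠ [0] := fun h =>
      ne_zero_of_mem_runWord (a := 0) (by rw [h]; simp) rfl
    simp [this]
  induction x with
  | zero => simp [numRuns, prevLetter]
  | succ x ih =>
    obtain ⟨ih1, ih2⟩ := ih
    have hl : (List.range (x + 1)).map Y = (List.range x).map Y ++ [Y x] := by
      rw [List.range_succ, List.map_append]
      rfl
    have h0 : prevLetter (colors Y) (x + 1) = colors Y x := rfl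
    by_cases hy : Y x = 0
    · have hy' := colors_eq_zero_iff.2 hy
      refine ⟨?_, fun h => absurd (h0.trans hy') h⟩
      have h1 : numRuns (colors Y) (x + 1) = numRuns (colors Y) x := by simp [numRuns, hy']
      rw [hl, List.splitBy_append, List.filter_append, ih1, h1, hy]
      · have h2 : ∀ i, runWord Y i (x + 1) = runWord Y i x := fun i => by
          rw [runWord_succ, if_neg (fun h => h.1 hy), List.append_nil]
        simp [h2, List.splitBy_of_isChain]
      · intro a _ b hb
        simp only [List.head?_cons, Option.mem_def, Option.some.injEq] at hb
        simp [runRel, ← hb, hy]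
    · have hy' : colors Y x ≠ 0 := fun h => hy (colors_eq_zero_iff.1 h)
      suffices h : ∃ l, (List.range (x + 1)).map Y =
        l ++ runWord Y (numRuns (colors Y) (x + 1) - 1) (x + 1) ∧
        runWord Y (numRuns (colors Y) (x + 1) - 1) (x + 1) ≠ [] ∧
        (∀ a ∈ l.getLast?, ∀ b ∈ (runWord Y (numRuns (colors Y) (x + 1) - 1) (x + 1)).head?,
          runRel a b = false) ∧
        ((l.splitBy runRel).filter fun w => decide (w ≠ [0])) =
          (List.range (numRuns (colors Y) (x + 1) - 1)).map fun i => runWord Y i (x + 1) from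
        ⟨suff (x + 1) hy' h, fun _ => h⟩
      by_cases hlt : prevLetter (colors Y) x < colors Y x
      · have h1 : numRuns (colors Y) (x + 1) = numRuns (colors Y) x + 1 := by simp [numRuns, hlt]
        have h2 : runWord Y (numRuns (colors Y) x) (x + 1) = [Y x] := by
          rw [runWord_succ, if_pos ⟨hy, h1⟩, runWord_eq_nil le_rfl, List.nil_append]
        rw [h1, Nat.add_sub_cancel, h2]
        refine ⟨(List.range x).map Y, hl, by simp, ?_, ?_⟩
        · intro a ha b hb
          have h3 := getLast?_map_range Y ha
          simp only [List.head?_cons, Option.mem_def, Option.some.injEq] at hb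
          rw [runRel, decide_eq_false_iff_not, ← hb]
          intro h4
          have h5 : colors Y x ≤ (a : ℕ) := h4.2
          omega
        · rw [ih1]
          refine List.map_congr_left fun i hi => ?_
          rw [List.mem_range] at hi
          rw [runWord_succ_of_ne (by omega)]
      · have h1 : numRuns (colors Y) (x + 1) = numRuns (colors Y) x := by simp [numRuns, hlt]
        have h3 : prevLetter (colors Y) x ≠ 0 := by omega
        have hpos := numRuns_pos (colors Y) h3
        obtain ⟨r, hr⟩ : ∃ r, numRuns (colors Y) x = r + 1 := ⟨_, (Nat.succ_pred hpos.ne').symm⟩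
        obtain ⟨l, i1, i2, i3, i4⟩ := ih2 h3
        rw [hr, Nat.add_sub_cancel] at i1 i2 i3 i4
        have h2 : runWord Y r (x + 1) = runWord Y r x ++ [Y x] := by
          rw [runWord_succ, if_pos ⟨hy, h1.trans hr⟩]
        rw [h1, hr, Nat.add_sub_cancel, h2]
        refine ⟨l, ?_, by simp, ?_, ?_⟩
        · rw [hl, i1, List.append_assoc]
        · rw [List.head?_append_of_ne_nil _ i2]
          exact i3
        · rw [i4]
          refine List.map_congr_left fun i hi => ?_
          rw [List.mem_range] at hi
          rw [runWord_succ_of_ne (by omega)]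

/-! ### The quantities of a configuration as a whole -/

/-- A bound for the occupied boxes. -/
def extent {κ : ℕ} (Y : Config κ) : ℕ := Y.support.sup id + 1

theorem ballRuns_eq {κ : ℕ} (Y : Config κ) :
    ballRuns Y = (List.range (numRuns (colors Y) (extent Y))).map fun i =>
      runWord Y i (extent Y) :=
  (splitBy_prefix Y (extent Y)).1

theorem numRuns_eq_of_zero {Y : ℕ → ℕ} {T T' : ℕ} (hT : T ≤ T') (hY : ∀ x, T ≤ x → Y x = 0) :
    numRuns Y T' = numRuns Y T := by
  induction T', hT using Nat.le_induction with
  | base => rfl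
  | succ x hx ih => simp [numRuns, ih, hY x hx]

theorem numGeRuns_eq_of_zero {Y : ℕ → ℕ} {T T' i v : ℕ} (hT : T ≤ T')
    (hY : ∀ x, T ≤ x → Y x = 0) (hv : v ≠ 0) : numGeRuns Y i v T' = numGeRuns Y i v T := by
  induction T', hT using Nat.le_induction with
  | base => rfl
  | succ x hx ih => simp [numGeRuns, ih, hY x hx, hv]

/-- The number of runs. -/
def runCount {κ : ℕ} (Y : Config κ) : ℕ := numRuns (colors Y) (extent Y)

/-- The number of balls in the first `i` runs whose color is at least `v`. -/
def ballCount {κ : ℕ} (Y : Config κ) (i v : ℕ) : ℕ := numGeRuns (colors Y) i v (extent Y)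

theorem numRuns_eq_runCount {κ : ℕ} (Y : Config κ) {T : ℕ} (hT : extent Y ≤ T) :
    numRuns (colors Y) T = runCount Y :=
  numRuns_eq_of_zero hT fun _ => colors_eq_zero_of_le Y

theorem numGeRuns_eq_ballCount {κ : ℕ} (Y : Config κ) (i : ℕ) {v T : ℕ} (hv : v ≠ 0)
    (hT : extent Y ≤ T) : numGeRuns (colors Y) i v T = ballCount Y i v :=
  numGeRuns_eq_of_zero hT (fun _ => colors_eq_zero_of_le Y) hv

theorem prevLetter_eq_zero {κ : ℕ} (Y : Config κ) {T : ℕ} (hT : extent Y < T) :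
    prevLetter (colors Y) T = 0 := by
  cases T with
  | zero => rfl
  | succ T => exact colors_eq_zero_of_le Y (Nat.lt_succ_iff.1 hT)

theorem runCount_evolve {κ : ℕ} (Y : Config κ) : runCount (evolve Y) = runCount Y := by
  have h := (isOutput_evolve Y).numRuns_add (extent Y + extent (evolve Y) + 1)
  rw [prevLetter_eq_zero Y (by omega), numRuns_eq_runCount Y (by omega),
    numRuns_eq_runCount (evolve Y) (by omega)] at h
  simpa using h

theorem ballCount_evolve_le {κ : ℕ} (Y : Config κ) (i : ℕ) {v : ℕ} (hv : v ≠ 0) :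
    ballCount (evolve Y) i v ≤ ballCount Y i v := by
  have h := (isOutput_evolve Y).numGeRuns_le i hv (extent Y + extent (evolve Y))
  rwa [numGeRuns_eq_ballCount _ i hv (by omega), numGeRuns_eq_ballCount _ i hv (by omega)] at h

theorem ballCount_eq_of_runCount_le {κ : ℕ} (Y : Config κ) {i v : ℕ}
    (hi : runCount Y ≤ i) : ballCount Y i v = ballCount Y (runCount Y) v := by
  rw [ballCount, ballCount, numGeRuns_eq _ hi, numGeRuns_eq _ (le_refl (runCount Y))]

theorem ballCount_eq_zero {κ : ℕ} (Y : Config κ) (i : ℕ) {v : ℕ} (hv : κ < v) :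
    ballCount Y i v = 0 := by
  have : ∀ x, numGeRuns (colors Y) i v x = 0 := by
    intro x
    induction x with
    | zero => rfl
    | succ x ih =>
      have := colors_le Y x
      rw [numGeRuns, ih, if_neg (by omega)]
  exact this _

/-- Differences of the counts in `i` and in `v` give the multiplicity of each color in each run, and
a sorted word is determined by its multiplicities. -/
theorem ballRuns_congr {κ : ℕ} {Y Z : Config κ} (h : runCount Y = runCount Z)
    (h' : ∀ i v, v ≠ 0 → ballCount Y i v = ballCount Z i v) : ballRuns Y = ballRuns Z := by
  rw [ballRuns_eq, ballRuns_eq]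
  change (List.range (runCount Y)).map _ = (List.range (runCount Z)).map _
  rw [h]
  refine List.map_congr_left fun i _ => ?_
  have hcount : ∀ v, v ≠ 0 →
      (runWord Y i (extent Y)).countP (fun a : Fin (κ + 1) => decide (v ≤ (a : ℕ))) =
      (runWord Z i (extent Z)).countP (fun a : Fin (κ + 1) => decide (v ≤ (a : ℕ))) := by
    intro v hv
    have h1 := countP_runWord Y i (extent Y) hv
    have h2 := countP_runWord Z i (extent Z) hv
    have h3 := h' i v hv
    have h4 := h' (i + 1) v hv
    simp only [ballCount] at h3 h4
    omega
  have hsplit : ∀ (l : List (Fin (κ + 1))) (a : Fin (κ + 1)),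
      l.countP (fun b : Fin (κ + 1) => decide ((a : ℕ) ≤ (b : ℕ))) =
        l.count a + l.countP (fun b : Fin (κ + 1) => decide ((a : ℕ) + 1 ≤ (b : ℕ))) := by
    intro l a
    induction l with
    | nil => rfl
    | cons b l ih =>
      simp only [List.countP_cons, List.count_cons, ih, beq_iff_eq, decide_eq_true_eq, Fin.ext_iff]
      split_ifs <;> omega
  refine List.Perm.eq_of_pairwise (fun a b _ _ h1 h2 => le_antisymm h2 h1)
    (runWord_sorted Y i _) (runWord_sorted Z i _) (List.perm_iff_count.2 fun a => ?_)
  by_cases ha : a = 0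
  · rw [List.count_eq_zero_of_not_mem fun h => ne_zero_of_mem_runWord h ha,
      List.count_eq_zero_of_not_mem fun h => ne_zero_of_mem_runWord h ha]
  · have h1 := hsplit (runWord Y i (extent Y)) a
    have h2 := hsplit (runWord Z i (extent Z)) a
    rw [hcount _ (Fin.val_ne_zero_iff.2 ha), hcount ((a : ℕ) + 1) (by omega)] at h1
    omega

/-! ### Existence of the soliton decomposition -/

/-- The numbers of balls in the first runs do not change any more. -/
def IsStable {κ : ℕ} (Y : Config κ) : Prop :=
  ∀ t i v, v ≠ 0 → ballCount (evolve^[t] Y) i v = ballCount Y i v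

theorem runCount_iterate {κ : ℕ} (Y : Config κ) (t : ℕ) :
    runCount (evolve^[t] Y) = runCount Y := by
  induction t with
  | zero => rfl
  | succ t ih => rw [Function.iterate_succ_apply', runCount_evolve, ih]

theorem ballCount_iterate_antitone {κ : ℕ} (Y : Config κ) (i : ℕ) {v : ℕ} (hv : v ≠ 0) :
    Antitone fun t => ballCount (evolve^[t] Y) i v :=
  antitone_nat_of_succ_le fun t => by
    rw [Function.iterate_succ_apply']
    exact ballCount_evolve_le _ i hv

theorem eventually_eq_of_antitone {f : ℕ → ℕ} (hf : Antitone f) :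
    ∀ᶠ s in atTop, ∀ t, f (s + t) = f s := by
  refine eventually_atTop.2 ⟨Function.argmin f, fun s hs t => ?_⟩
  have h1 := Function.argmin_le f (s + t)
  have h2 := hf hs
  have h3 := hf (Nat.le_add_right s t)
  omega

/-- Only `i` up to the conserved number of runs and `v` up to `κ` matter, so finitely many
non-increasing sequences of naturals have to settle. -/
theorem exists_isStable {κ : ℕ} (Y : Config κ) : ∃ s, IsStable (evolve^[s] Y) := by
  have h : ∀ᶠ s in atTop, ∀ i ∈ Finset.range (runCount Y + 1), ∀ v ∈ Finset.Icc 1 κ, ∀ t,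
      ballCount (evolve^[s + t] Y) i v = ballCount (evolve^[s] Y) i v := by
    rw [eventually_all_finset]
    intro i _
    rw [eventually_all_finset]
    intro v hv
    rw [Finset.mem_Icc] at hv
    exact eventually_eq_of_antitone (ballCount_iterate_antitone Y i (v := v) (by omega))
  obtain ⟨s, hs⟩ := h.exists
  refine ⟨s, fun t i v hv => ?_⟩
  rw [← Function.iterate_add_apply, add_comm t s]
  by_cases hv' : κ < v
  · rw [ballCount_eq_zero _ _ hv', ballCount_eq_zero _ _ hv']
  · have hv'' : v ∈ Finset.Icc 1 κ := Finset.mem_Icc.2 ⟨by omega, by omega⟩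
    by_cases hi : i ≤ runCount Y
    · exact hs i (Finset.mem_range.2 (by omega)) v hv'' t
    · rw [ballCount_eq_of_runCount_le _ (by rw [runCount_iterate]; omega),
        ballCount_eq_of_runCount_le (evolve^[s] Y) (by rw [runCount_iterate]; omega),
        runCount_iterate, runCount_iterate]
      exact hs _ (Finset.mem_range.2 (by omega)) v hv'' t

theorem IsStable.iterate {κ : ℕ} {Y : Config κ} (h : IsStable Y) (s : ℕ) :
    IsStable (evolve^[s] Y) := fun t i v hv => by
  rw [← Function.iterate_add_apply, h _ i v hv, h _ i v hv]

theorem IsStable.ballRuns_iterate {κ : ℕ} {Y : Config κ} (h : IsStable Y) (t : ℕ) :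
    ballRuns (evolve^[t] Y) = ballRuns Y :=
  ballRuns_congr (runCount_iterate Y t) fun i v hv => h t i v hv

/-- The number of boxes of `[0, T)` before the start of the run with index `i`. -/
def runStart (Y : ℕ → ℕ) (i T : ℕ) : ℕ :=
  ∑ x ∈ Finset.range T, if numRuns Y (x + 1) ≤ i then 1 else 0

theorem runStart_mono (Y : ℕ → ℕ) {i j : ℕ} (h : i ≤ j) (T : ℕ) :
    runStart Y i T ≤ runStart Y j T :=
  Finset.sum_le_sum fun x _ => by split_ifs <;> omega

/-- An output run starts where the corresponding input run ends, so the start moves by the length of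
the run. -/
theorem IsOutput.runStart_add {Y Z : ℕ → ℕ} (h : IsOutput Y Z) (i T : ℕ) :
    runStart Z i T + numGeRuns Y i 1 T = runStart Y i T + numGeRuns Y (i + 1) 1 T := by
  induction T with
  | zero => rfl
  | succ T ih =>
    have h1 := h.numRuns_add (T + 1)
    simp only [prevLetter] at h1
    simp only [runStart, Finset.sum_range_succ] at ih ⊢
    simp only [numGeRuns]
    by_cases hy : Y T = 0
    · simp only [hy, ne_eq, not_true, if_false, add_zero] at h1
      simp only [hy, h1]
      split_ifs <;> omega
    · simp only [hy, ne_eq, not_false_eq_true, if_true] at h1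
      split_ifs <;> omega

theorem runStart_iterate {κ : ℕ} {Y : Config κ} (h : IsStable Y) (i k : ℕ) :
    ∀ᶠ T in atTop, runStart (colors (evolve^[k] Y)) i T + k * ballCount Y i 1 =
      runStart (colors Y) i T + k * ballCount Y (i + 1) 1 := by
  induction k with
  | zero => simp
  | succ k ih =>
    filter_upwards [ih, eventually_ge_atTop (extent (evolve^[k] Y))] with T hT hT'
    have h1 := (isOutput_evolve (evolve^[k] Y)).runStart_add i T
    rw [numGeRuns_eq_ballCount _ _ one_ne_zero hT', numGeRuns_eq_ballCount _ _ one_ne_zero hT',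
      h k i 1 one_ne_zero, h k (i + 1) 1 one_ne_zero] at h1
    rw [Function.iterate_succ_apply']
    linarith

theorem runStart_eq_of_zero {Y : ℕ → ℕ} {i T T' : ℕ} (hT : T ≤ T') (hY : ∀ x, T ≤ x → Y x = 0)
    (hi : i < numRuns Y T) : runStart Y i T' = runStart Y i T := by
  refine (Finset.sum_subset (Finset.range_mono hT) fun x _ hx => ?_).symm
  rw [Finset.mem_range, not_lt] at hx
  have := numRuns_eq_of_zero (Y := Y) (T := T) (T' := x + 1) (by omega) hY
  rw [if_neg (by omega)]

/-- The length of the run with index `i`. -/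
def runLength {κ : ℕ} (Y : Config κ) (i : ℕ) : ℕ := (runWord Y i (extent Y)).length

theorem runLength_add {κ : ℕ} (Y : Config κ) (i : ℕ) :
    runLength Y i + ballCount Y i 1 = ballCount Y (i + 1) 1 := length_runWord Y i (extent Y)

theorem IsStable.runLength_le {κ : ℕ} {Y : Config κ} (h : IsStable Y) {i : ℕ}
    (hi : i + 1 < runCount Y) : runLength Y i ≤ runLength Y (i + 1) := by
  by_contra! hlt
  -- The initial gap is at most `b`, and a longer run `i` would gain at least one box per step, so
  -- it would have overtaken run `i + 1` after `b + 1` steps.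
  set b := runStart (colors Y) (i + 1) (extent Y) with hb
  obtain ⟨T, h1, h2, h3⟩ := ((runStart_iterate h i (b + 1)).and
    ((runStart_iterate h (i + 1) (b + 1)).and (eventually_ge_atTop (extent Y)))).exists
  rw [runStart_eq_of_zero h3 (fun _ => colors_eq_zero_of_le Y) hi, ← hb] at h2
  have h4 := runStart_mono (colors (evolve^[b + 1] Y)) (Nat.le_succ i) T
  rw [Nat.succ_eq_add_one] at h4
  have h5 := Nat.mul_le_mul_left (b + 1) (Nat.succ_le_of_lt hlt)
  rw [← runLength_add Y (i + 1)] at h2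
  rw [← runLength_add Y i] at h1
  rw [Nat.succ_eq_add_one, mul_add] at h5
  rw [mul_add] at h1 h2
  omega

theorem IsStable.pairwise_length {κ : ℕ} {Y : Config κ} (h : IsStable Y) :
    ((ballRuns Y).map List.length).Pairwise (· ≤ ·) := by
  rw [ballRuns_eq, List.map_map]
  have hmono : ∀ i j, i ≤ j → j < runCount Y → runLength Y i ≤ runLength Y j := by
    intro i j hij
    induction j, hij using Nat.le_induction with
    | base => exact fun _ => le_rfl
    | succ j _ ih => exact fun hj => (ih (by omega)).trans (h.runLength_le hj)
  rw [List.pairwise_map]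
  refine (List.pairwise_lt_range).imp_of_mem fun _ hb hab => ?_
  exact hmono _ _ (le_of_lt hab) (List.mem_range.1 hb)

theorem exists_isSolitonDecomposition {κ : ℕ} (Y : Config κ) :
    ∃ s, IsStable (evolve^[s] Y) ∧ IsSolitonDecomposition Y (ballRuns (evolve^[s] Y)) := by
  obtain ⟨s, hs⟩ := exists_isStable Y
  refine ⟨s, hs, eventually_atTop.2 ⟨s, fun t ht => ?_⟩, hs.pairwise_length⟩
  have := hs.ballRuns_iterate (t - s)
  rwa [← Function.iterate_add_apply, show t - s + s = t by omega] at this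

theorem IsSolitonDecomposition.unique {κ : ℕ} {Y : Config κ} {L L' : List (List (Fin (κ + 1)))}
    (h : IsSolitonDecomposition Y L) (h' : IsSolitonDecomposition Y L') : L = L' := by
  obtain ⟨t, h1, h2⟩ := (h.1.and h'.1).exists
  exact h1.symm.trans h2

/-! ### The energies of the soliton decomposition -/

theorem numGeRuns_eq_of_lt (Y : ℕ → ℕ) {i v x T : ℕ} (hT : x ≤ T) (h : i < numRuns Y (x + 1)) :
    numGeRuns Y i v T = numGeRuns Y i v x := by
  induction T, hT using Nat.le_induction with
  | base => rfl
  | succ T hT ih =>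
    rw [numGeRuns_succ_of_lt Y (h.trans_le (numRuns_mono Y (by omega))), ih]

/-- The carrier with capacity `c` holds as much of the current run as possible. -/
theorem min_le_load (c : ℕ) (Y : ℕ → ℕ) {x : ℕ} (hx : prevLetter Y x ≠ 0) :
    min (numGe Y 1 x - numGeRuns Y (numRuns Y x - 1) 1 x) c ≤ load c Y x (prevLetter Y x) := by
  induction x with
  | zero => simp [numGe]
  | succ x ih =>
    simp only [prevLetter] at hx ⊢
    have h0 := load_le c Y x (Y x)
    by_cases h : prevLetter Y x < Y x
    · have h1 : numRuns Y (x + 1) = numRuns Y x + 1 := by simp [numRuns, h]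
      rw [numGeRuns_succ_of_lt Y (by omega), h1, numGeRuns_eq Y (by omega)]
      simp only [numGe, load, insertLetter, le_refl, and_self, if_true, lt_irrefl, if_false]
      split_ifs <;> omega
    · have h1 : numRuns Y (x + 1) = numRuns Y x := by simp [numRuns, h]
      have h2 := numRuns_pos Y (x := x) (by omega)
      have h3 := ih (by omega)
      have h4 : load c Y x (prevLetter Y x) ≤ load c Y x (Y x) :=
        load_antitone c Y x (not_lt.1 h)
      rw [numGeRuns_succ_of_lt Y (by omega), h1]
      simp only [numGe, load, insertLetter, le_refl, and_self, if_true, lt_irrefl, if_false]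
      split_ifs <;> omega

/-- The right alternative means that the carrier holds, at or above the last letter, more balls than
the current run supplied. It persists to the end of the run and is ruled out there; otherwise each
run yields gains from exactly its first `c` balls, or all of them if it is shorter. -/
theorem IsOutput.energy_prefix {Y Z : ℕ → ℕ} (h : IsOutput Y Z)
    (hs : ∀ i, ∀ᶠ T in atTop, numGeRuns Z i 1 T = numGeRuns Y i 1 T) (c x : ℕ) :
    energy c Y x = (∑ i ∈ Finset.range (numRuns Y x),
      min (numGeRuns Y (i + 1) 1 x - numGeRuns Y i 1 x) c) ∨
    prevLetter Y x ≠ 0 ∧ numGe Y 1 x <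
      numGeRuns Y (numRuns Y x - 1) 1 x + pile Y x (prevLetter Y x) := by
  induction x with
  | zero => exact Or.inl rfl
  | succ x ih =>
    -- At the end of a run such an excess would leave the earlier output runs with fewer balls than
    -- the earlier input runs, contrary to `hs`.
    have hend : Y x = 0 ∨ prevLetter Y x < Y x → ¬ (prevLetter Y x ≠ 0 ∧ numGe Y 1 x <
        numGeRuns Y (numRuns Y x - 1) 1 x + pile Y x (prevLetter Y x)) := by
      rintro hy ⟨h1, h2⟩
      have h3 := numRuns_pos Y h1
      obtain ⟨T, hT, hT'⟩ := ((hs (numRuns Y x - 1)).and (eventually_ge_atTop x)).exists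
      have h4 := h.numRuns_add (x + 1)
      have h5 := h.numRuns_add x
      have h6 : numRuns Y (x + 1) = numRuns Y x + if prevLetter Y x < Y x then 1 else 0 := rfl
      change _ + (if Y x ≠ 0 then 1 else 0) = _ at h4
      rw [h6] at h4
      rw [if_pos h1] at h5
      have h7 := h.numGe_add_pile one_ne_zero x
      have h8 : pile Y x (prevLetter Y x) ≤ pile Y x 1 := pile_antitone Y x (by omega)
      rw [numGeRuns_eq_of_lt Z hT' (by split_ifs at h4 <;> omega), numGeRuns_eq Z (by omega)] at hT
      have h9 := numGeRuns_mono Y (numRuns Y x - 1) 1 hT'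
      omega
    rw [energy_succ]
    by_cases hy : Y x = 0
    · left
      have h1 : numRuns Y (x + 1) = numRuns Y x := by simp [numRuns, hy]
      have h2 : ∀ i, numGeRuns Y i 1 (x + 1) = numGeRuns Y i 1 x := fun i => by
        simp [numGeRuns, hy]
      simp only [h1, h2, gain_of_eq_zero c hy, add_zero]
      exact ih.resolve_right (hend (Or.inl hy))
    · have hp := load_le_pile c Y x hy
      have hle := load_le c Y x (Y x)
      have hpile : pile Y (x + 1) (Y x) = pile Y x (Y x) + 1 := by simp [pile, pushLetter, hy]
      have hge : numGe Y 1 (x + 1) = numGe Y 1 x + 1 := by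
        rw [numGe, if_pos (by omega)]
      simp only [prevLetter, hpile, hge, gain]
      by_cases hlt : prevLetter Y x < Y x
      · have h1 : numRuns Y (x + 1) = numRuns Y x + 1 := by simp [numRuns, hlt]
        have h2 : ∀ i ∈ Finset.range (numRuns Y x),
            min (numGeRuns Y (i + 1) 1 (x + 1) - numGeRuns Y i 1 (x + 1)) c =
              min (numGeRuns Y (i + 1) 1 x - numGeRuns Y i 1 x) c := fun i hi => by
          rw [Finset.mem_range] at hi
          rw [numGeRuns_succ_of_lt Y (by omega), numGeRuns_succ_of_lt Y (by omega)]
        have h3 := ih.resolve_right (hend (Or.inr hlt))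
        rw [h1, Finset.sum_range_succ, Finset.sum_congr rfl h2, ← h3,
          numGeRuns_eq Y (v := 1) h1.le, hge, numGeRuns_succ_of_lt Y (by omega),
          Nat.add_sub_cancel, numGeRuns_eq Y (v := 1) (x := x) le_rfl]
        have h4 : numGeRuns Y (numRuns Y x) 1 (x + 1) = numGe Y 1 x := by
          rw [numGeRuns_succ_of_lt Y (by omega), numGeRuns_eq Y le_rfl]
        by_cases hc : load c Y x (Y x) < c
        · left
          rw [if_pos hc]
          omega
        · rw [if_neg hc]
          by_cases hc0 : c = 0
          · left
            omega
          · right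
            exact ⟨hy, by omega⟩
      · have h1 : numRuns Y (x + 1) = numRuns Y x := by simp [numRuns, hlt]
        have h0 : prevLetter Y x ≠ 0 := by omega
        have hpos := numRuns_pos Y h0
        obtain ⟨r, hr⟩ : ∃ r, numRuns Y x = r + 1 := ⟨_, (Nat.succ_pred hpos.ne').symm⟩
        have hpp : pile Y x (prevLetter Y x) ≤ pile Y x (Y x) := pile_antitone Y x (not_lt.1 hlt)
        have hlp : load c Y x (prevLetter Y x) ≤ load c Y x (Y x) :=
          load_antitone c Y x (not_lt.1 hlt)
        have hmin := min_le_load c Y h0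
        have h2 : ∀ i ∈ Finset.range r,
            min (numGeRuns Y (i + 1) 1 (x + 1) - numGeRuns Y i 1 (x + 1)) c =
              min (numGeRuns Y (i + 1) 1 x - numGeRuns Y i 1 x) c := fun i hi => by
          rw [Finset.mem_range] at hi
          rw [numGeRuns_succ_of_lt Y (by omega), numGeRuns_succ_of_lt Y (by omega)]
        have h3 := BoxBall.numGeRuns_le Y r 1 x
        rw [hr, Finset.sum_range_succ, numGeRuns_eq Y (v := 1) hr.le, Nat.add_sub_cancel] at ih
        rw [hr, Nat.add_sub_cancel] at hmin
        rw [h1, hr, Finset.sum_range_succ, Finset.sum_congr rfl h2,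
          numGeRuns_eq Y (v := 1) (h1.trans hr).le, hge, Nat.add_sub_cancel,
          numGeRuns_succ_of_lt Y (i := r) (by omega)]
        rcases ih with ih | ⟨-, ih⟩
        · rw [ih]
          by_cases hc : load c Y x (Y x) < c
          · rw [if_pos hc]
            left
            omega
          · rw [if_neg hc]
            -- A refused ball is harmless once the run has supplied `c` balls. If it is refused
            -- earlier, the carrier is blocked by older balls, which is the right alternative.
            by_cases hk : c ≤ numGe Y 1 x - numGeRuns Y r 1 x
            · left
              omega
            · right
              exact ⟨hy, by omega⟩
        · right
          exact ⟨hy, by omega⟩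

theorem IsStable.energy_eq {κ : ℕ} {Y : Config κ} (h : IsStable Y) (c : ℕ) :
    ∀ᶠ T in atTop, energy c (colors Y) T =
      ((ballRuns Y).map fun w => min w.length c).sum := by
  have hs : ∀ i, ∀ᶠ T in atTop, numGeRuns (colors (evolve Y)) i 1 T =
      numGeRuns (colors Y) i 1 T := by
    intro i
    filter_upwards [eventually_ge_atTop (extent Y), eventually_ge_atTop (extent (evolve Y))]
      with T h1 h2
    rw [numGeRuns_eq_ballCount _ i one_ne_zero h1, numGeRuns_eq_ballCount _ i one_ne_zero h2]
    exact h 1 i 1 one_ne_zero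
  filter_upwards [eventually_gt_atTop (extent Y)] with T hT
  rcases (isOutput_evolve Y).energy_prefix hs c T with h1 | h1
  · have hsum : ∀ (n : ℕ) (f : ℕ → ℕ), ∑ i ∈ Finset.range n, f i = ((List.range n).map f).sum := by
      intro n f
      induction n with
      | zero => rfl
      | succ n ih => simp [Finset.sum_range_succ, List.range_succ, ih]
    rw [h1, ballRuns_eq, List.map_map, numRuns_eq_runCount Y hT.le, hsum]
    change _ = ((List.range (runCount Y)).map _).sum
    congr 1
    refine List.map_congr_left fun i _ => ?_
    rw [numGeRuns_eq_ballCount Y _ one_ne_zero hT.le, numGeRuns_eq_ballCount Y _ one_ne_zero hT.le,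
      ← runLength_add Y i, Nat.add_sub_cancel]
    rfl
  · exact absurd (prevLetter_eq_zero Y hT) h1.1

/-- The number of solitons with length greater than `c` is a difference of energies. -/
theorem IsSolitonDecomposition.countP_add_energy {κ : ℕ} (hκ : 1 ≤ κ) {Y : Config κ}
    {L : List (List (Fin (κ + 1)))} (hL : IsSolitonDecomposition Y L) (c : ℕ) :
    ∀ᶠ T in atTop, energy c (colors Y) T +
      (L.map List.length).countP (fun l => decide (c + 1 ≤ l)) = energy (c + 1) (colors Y) T := by
  obtain ⟨s, hs, hs'⟩ := exists_isSolitonDecomposition Y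
  obtain rfl := hL.unique hs'
  filter_upwards [hs.energy_eq c, hs.energy_eq (c + 1), energy_evolve_iterate hκ c Y s,
    energy_evolve_iterate hκ (c + 1) Y s] with T h1 h2 h3 h4
  rw [← h3, ← h4, h1, h2]
  generalize ballRuns (evolve^[s] Y) = L
  induction L with
  | nil => rfl
  | cons w L ih =>
    simp only [List.map_cons, List.sum_cons, List.countP_cons, decide_eq_true_eq]
    split_ifs <;> omega

/-! ### Truncated configurations -/

theorem load_congr (c : ℕ) {Y Z : ℕ → ℕ} {t : ℕ} (h : ∀ s < t, Y s = Z s) :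
    load c Y t = load c Z t := by
  induction t with
  | zero => rfl
  | succ t ih => rw [load, load, ih fun s hs => h s (by omega), h t (by omega)]

theorem energy_congr (c : ℕ) {Y Z : ℕ → ℕ} {n : ℕ} (h : ∀ s < n, Y s = Z s) :
    energy c Y n = energy c Z n := by
  refine Finset.sum_congr rfl fun t ht => ?_
  rw [Finset.mem_range] at ht
  rw [gain, gain, load_congr c fun s hs => h s (by omega), h t ht]

/-- The letters of a sequence of colors as natural numbers. -/
def letters {κ : ℕ} (X : ℕ → Fin (κ + 1)) (t : ℕ) : ℕ := X t

theorem colors_truncate {κ : ℕ} (X : ℕ → Fin (κ + 1)) (n x : ℕ) :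
    colors (truncate X n) x = if x < n then letters X x else 0 := by
  change ((if x < n then X x else 0 : Fin (κ + 1)) : ℕ) = _
  split_ifs <;> rfl

theorem energy_truncate {κ : ℕ} (X : ℕ → Fin (κ + 1)) (c : ℕ) {n T : ℕ} (hT : n ≤ T) :
    energy c (colors (truncate X n)) T = energy c (letters X) n := by
  rw [energy_eq_of_zero c hT fun x hx => by rw [colors_truncate, if_neg (by omega)]]
  exact energy_congr c fun s hs => by rw [colors_truncate, if_pos hs]

theorem IsSolitonDecomposition.countP_truncate {κ : ℕ} (hκ : 1 ≤ κ) {X : ℕ → Fin (κ + 1)} {n : ℕ}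
    {L : List (List (Fin (κ + 1)))} (hL : IsSolitonDecomposition (truncate X n) L) (c : ℕ) :
    energy c (letters X) n + (L.map List.length).countP (fun l => decide (c + 1 ≤ l)) =
      energy (c + 1) (letters X) n := by
  obtain ⟨T, h1, h2⟩ := ((hL.countP_add_energy hκ c).and (eventually_ge_atTop n)).exists
  rwa [energy_truncate X c h2, energy_truncate X (c + 1) h2] at h1

/-! ### The carrier process -/

/-- The entries are non-increasing, so those at least `v` form an initial segment, whose length is
the threshold count. -/
theorem le_carrier_iff {κ : ℕ} (X : ℕ → Fin (κ + 1)) (t j : ℕ) {v : ℕ} (hv : v ≠ 0) :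
    v ≤ ((carrier X t).1 j : ℕ) ↔ j < pile (letters X) t v := by
  induction t generalizing j v with
  | zero => simp [carrier, pile, hv]
  | succ t ih =>
    rw [carrier, pile, pushLetter]
    have hl : letters X t = ((X t : Fin (κ + 1)) : ℕ) := rfl
    by_cases hy : X t = 0
    · have hy' : letters X t = 0 := by rw [hl, hy, Fin.val_zero]
      have hnext : ((carrier X t).next (X t)).1 j = (carrier X t).1 (j + 1) :=
        congrArg (fun g : Carrier κ => g.1 j) (dif_pos hy : (carrier X t).next (X t) = _)
      rw [hnext, if_pos hy', ih (j + 1) hv]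
      omega
    · have hy' : letters X t ≠ 0 := fun h => hy (Fin.val_eq_zero_iff.1 h)
      rw [if_neg hy']
      obtain ⟨h1, h2⟩ := firstSmaller_spec (carrier X t) hy
      set q := firstSmaller (carrier X t) (X t)
      have h3 : q = pile (letters X) t (letters X t) := by
        have h4 : ¬ q < pile (letters X) t (letters X t) := by
          rw [← ih q hy', hl, not_le]
          exact h1
        refine le_antisymm ?_ (not_lt.1 h4)
        by_contra h5
        have h6 : letters X t ≤ ((carrier X t).1 (pile (letters X) t (letters X t)) : ℕ) :=
          h2 _ (not_le.1 h5)
        rw [ih _ hy'] at h6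
        exact lt_irrefl _ h6
      have h4 := ih j hv
      have h5 : v ≤ letters X t → pile (letters X) t (letters X t) ≤ pile (letters X) t v :=
        fun h => pile_antitone _ t h
      have h6 : letters X t ≤ v → pile (letters X) t v ≤ pile (letters X) t (letters X t) :=
        fun h => pile_antitone _ t h
      have hnext : ((carrier X t).next (X t)).1 j = if j = q then X t else (carrier X t).1 j :=
        (congrArg (fun g : Carrier κ => g.1 j) (dif_neg hy : (carrier X t).next (X t) = _)).trans
          ((congrFun (Finsupp.coe_update _ _ _) j).trans (Function.update_apply ..))
      rw [hnext]
      by_cases hj : j = q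
      · rw [if_pos hj, ← hl]
        split_ifs <;> omega
      · rw [if_neg hj, h4]
        split_ifs <;> omega

theorem height_eq_pile {κ : ℕ} (X : ℕ → Fin (κ + 1)) (t : ℕ) :
    height X t = pile (letters X) t 1 := by
  have hsupp : ∀ j, (carrier X t).1 j ≠ 0 ↔ j ∈ Finset.range (pile (letters X) t 1) := fun j => by
    rw [Finset.mem_range, ← le_carrier_iff X t j one_ne_zero, Nat.one_le_iff_ne_zero,
      Fin.val_ne_zero_iff]
  have h1 := Finset.card_eq_sum_card_fiberwise (s := Finset.range (pile (letters X) t 1))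
    (t := Finset.univ) (f := fun j => (carrier X t).1 j)
    (fun _ _ => Finset.mem_coe.2 (Finset.mem_univ _))
  rw [Finset.card_range, Fin.sum_univ_succ, Finset.card_eq_zero.2, zero_add] at h1
  · rw [h1, height]
    refine Finset.sum_congr rfl fun i _ => ?_
    rw [carrierCount, ← Set.ncard_coe_finset]
    congr 1
    ext j
    simp only [Set.mem_ofPred_eq, Finset.coe_filter, ← hsupp]
    exact ⟨fun h => ⟨h ▸ Fin.succ_ne_zero i, h⟩, fun h => h.2⟩
  · rw [Finset.filter_eq_empty_iff]
    exact fun j hj => (hsupp j).2 hj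

theorem carrierCount_eq_zero_iff {κ : ℕ} (X : ℕ → Fin (κ + 1)) (t : ℕ) :
    carrierCount X t = 0 ↔ pile (letters X) t 1 = 0 := by
  rw [← height_eq_pile, height, Finset.sum_eq_zero_iff]
  exact ⟨fun h i _ => by rw [h]; rfl, fun h => funext fun i => h i (Finset.mem_univ i)⟩

/-! ### Energies and heights -/

/-- As long as the capacities `c` and `c + 1` yield the same energies, the carrier does not reach
the height `c + 1`. -/
theorem load_eq_pile_of_gain_eq {Y : ℕ → ℕ} {c s t : ℕ} (hs : pile Y s 1 = 0) (hst : s ≤ t)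
    (h : ∀ u, s ≤ u → u < t → gain c Y u = gain (c + 1) Y u) :
    ∀ v, v ≠ 0 → load c Y t v = pile Y t v ∧ load (c + 1) Y t v = pile Y t v := by
  induction t, hst using Nat.le_induction with
  | base =>
    intro v hv
    have h1 : pile Y s v ≤ pile Y s 1 := pile_antitone Y s (by omega)
    have h2 := load_le_pile c Y s hv
    have h3 := load_le_pile (c + 1) Y s hv
    omega
  | succ t hst ih =>
    intro v hv
    have ih' := ih fun u hu hu' => h u hu (by omega)
    obtain ⟨h1, h2⟩ := ih' v hv
    by_cases hy : Y t = 0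
    · have h3 := load_zero_right c Y t
      have h4 := load_zero_right (c + 1) Y t
      have hv' : 0 < v := by omega
      simp only [load, pile, insertLetter, pushLetter, hy, h3, h4, lt_irrefl, if_false, if_true,
        h1, h2, hv', and_self]
    · obtain ⟨h3, h4⟩ := ih' (Y t) hy
      -- The common count at `Y t` is at most `c`, so capacity `c + 1` accepts the ball. Equal gains
      -- then make capacity `c` accept it as well.
      have h5 := h t hst (Nat.lt_succ_self t)
      have h6 := load_le c Y t (Y t)
      simp only [gain] at h5
      simp only [load, pile, insertLetter, pushLetter]
      split_ifs at * <;> omega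

theorem exists_gain_lt {Y : ℕ → ℕ} {c s t : ℕ} (hs : pile Y s 1 = 0) (hst : s ≤ t)
    (ht : c + 1 ≤ pile Y t 1) : ∃ u, s ≤ u ∧ u < t ∧ gain c Y u < gain (c + 1) Y u := by
  by_contra! h
  have h1 := (load_eq_pile_of_gain_eq hs hst fun u hu hu' =>
    le_antisymm (gain_mono (Nat.le_succ c) Y u) (h u hu hu')) 1 one_ne_zero
  have h2 := load_le c Y t 1
  omega

/-- A ball refused by capacity `c` would push the infinite capacity carrier above height `c`. -/
theorem load_eq_pile_of_pile_le {Y : ℕ → ℕ} {c t : ℕ} (h : ∀ u ≤ t, pile Y u 1 ≤ c) :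
    ∀ v, v ≠ 0 → load c Y t v = pile Y t v := by
  induction t with
  | zero =>
    intro v hv
    simp [load, pile, hv]
  | succ t ih =>
    intro v hv
    have ih' := ih fun u hu => h u (by omega)
    have h1 := ih' v hv
    by_cases hy : Y t = 0
    · have h3 := load_zero_right c Y t
      have hv' : 0 < v := by omega
      simp only [load, pile, insertLetter, pushLetter, hy, h3, lt_irrefl, if_false, if_true,
        h1, hv']
    · have h3 := ih' (Y t) hy
      have h4 := h (t + 1) le_rfl
      have h5 : pile Y (t + 1) (Y t) ≤ pile Y (t + 1) 1 := pile_antitone Y _ (by omega)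
      have h6 : pile Y (t + 1) (Y t) = pile Y t (Y t) + 1 := by simp [pile, pushLetter, hy]
      simp only [load, insertLetter]
      simp only [pile, pushLetter]
      split_ifs <;> omega

theorem gain_eq_of_pile_le {Y : ℕ → ℕ} {c t : ℕ} (h : ∀ u ≤ t + 1, pile Y u 1 ≤ c) :
    gain c Y t = if Y t = 0 then 0 else 1 := by
  by_cases hy : Y t = 0
  · rw [if_pos hy, gain_of_eq_zero c hy]
  · have h3 := load_eq_pile_of_pile_le (t := t) (fun u hu => h u (by omega)) (Y t) hy
    have h4 := h (t + 1) le_rfl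
    have h5 : pile Y (t + 1) (Y t) ≤ pile Y (t + 1) 1 := pile_antitone Y _ (by omega)
    have h6 : pile Y (t + 1) (Y t) = pile Y t (Y t) + 1 := by simp [pile, pushLetter, hy]
    rw [if_neg hy, gain, if_pos (by omega)]

theorem energy_succ_eq_of_pile_le {Y : ℕ → ℕ} {c n : ℕ} (h : ∀ u ≤ n, pile Y u 1 ≤ c) :
    energy (c + 1) Y n = energy c Y n := by
  refine Finset.sum_congr rfl fun t ht => ?_
  rw [Finset.mem_range] at ht
  rw [gain_eq_of_pile_le fun u hu => h u (by omega),
    gain_eq_of_pile_le fun u hu => (h u (by omega)).trans (Nat.le_succ c)]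

/-! ### Visits and excursions -/

theorem numVisits_succ {κ : ℕ} (X : ℕ → Fin (κ + 1)) (t : ℕ) :
    numVisits X (t + 1) = numVisits X t + if carrierCount X (t + 1) = 0 then 1 else 0 := by
  rw [numVisits, ← Finset.insert_Icc_right_eq_Icc_add_one (by omega), Finset.filter_insert]
  split_ifs with h
  · rw [Finset.card_insert_of_notMem (by simp)]
    rfl
  · rfl

theorem numVisits_mono {κ : ℕ} (X : ℕ → Fin (κ + 1)) : Monotone (numVisits X) :=
  monotone_nat_of_le_succ fun t => by simp [numVisits_succ]

theorem visitTime_le_iff {κ : ℕ} (X : ℕ → Fin (κ + 1)) (k t : ℕ) :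
    visitTime X k ≤ t ↔ k ≤ numVisits X t := by
  induction k generalizing t with
  | zero => simp [visitTime]
  | succ k ih =>
    have h1 : visitTime X (k + 1) ≤ t ↔
        ∃ w < t, carrierCount X (w + 1) = 0 ∧ k ≤ numVisits X w := by
      -- Passing to a strict bound turns the infimum into the existence of a visit, so the value `⊤`
      -- needs no separate case.
      rw [visitTime, ← ENat.lt_add_one_iff (ENat.natCast_ne_top t), sInf_lt_iff]
      constructor
      · rintro ⟨s, ⟨u, rfl, hu, hu0⟩, hut⟩
        rw [ENat.lt_add_one_iff (ENat.natCast_ne_top t), Nat.cast_le] at hut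
        obtain ⟨w, rfl⟩ : ∃ w, u = w + 1 := by
          cases u with
          | zero => simp at hu
          | succ w => exact ⟨w, rfl⟩
        refine ⟨w, hut, hu0, (ih w).1 ?_⟩
        rwa [Nat.cast_add, Nat.cast_one, ENat.lt_add_one_iff (ENat.natCast_ne_top w)] at hu
      · rintro ⟨w, hw, hw0, hk⟩
        refine ⟨_, ⟨w + 1, rfl, ?_, hw0⟩, ?_⟩
        · rw [Nat.cast_add, Nat.cast_one, ENat.lt_add_one_iff (ENat.natCast_ne_top w)]
          exact (ih w).2 hk
        · rw [ENat.lt_add_one_iff (ENat.natCast_ne_top t), Nat.cast_le]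
          exact hw
    rw [h1]
    constructor
    · rintro ⟨w, hw, hw0, hk⟩
      have h2 := numVisits_mono X (show w + 1 ≤ t from hw)
      rw [numVisits_succ, if_pos hw0] at h2
      omega
    · clear h1
      intro h
      induction t with
      | zero => simp [numVisits] at h
      | succ t iht =>
        have h2 := numVisits_succ X t
        by_cases hk : k + 1 ≤ numVisits X t
        · obtain ⟨w, hw, hw'⟩ := iht hk
          exact ⟨w, by omega, hw'⟩
        · split_ifs at h2 with h0
          · exact ⟨t, by omega, h0, by omega⟩
          · omega

theorem visitTime_mono {κ : ℕ} (X : ℕ → Fin (κ + 1)) : Monotone (visitTime X) :=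
  monotone_nat_of_le_succ fun k => by
    rw [visitTime]
    refine le_sInf ?_
    rintro s ⟨t, rfl, ht, -⟩
    exact ht.le

theorem pile_visitTime {κ : ℕ} {X : ℕ → Fin (κ + 1)} {k s : ℕ} (h : visitTime X k = s) :
    pile (letters X) s 1 = 0 := by
  cases k with
  | zero =>
    have : s = 0 := by
      rw [visitTime] at h
      exact_mod_cast h.symm
    rw [this]
    rfl
  | succ k =>
    rw [visitTime] at h
    have hne : {s : ℕ∞ | ∃ t : ℕ, s = t ∧ visitTime X k < t ∧ carrierCount X t = 0}.Nonempty := by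
      by_contra hcon
      rw [Set.not_nonempty_iff_eq_empty] at hcon
      rw [hcon, sInf_empty] at h
      exact ENat.natCast_ne_top s h.symm
    obtain ⟨t, ht, -, ht0⟩ := csInf_mem hne
    rw [h, Nat.cast_inj] at ht
    rw [ht]
    exact (carrierCount_eq_zero_iff X t).1 ht0

theorem le_excursionHeight_iff {κ : ℕ} (X : ℕ → Fin (κ + 1)) (k c : ℕ) :
    ((c + 1 : ℕ) : ℕ∞) ≤ excursionHeight X k ↔
      ∃ t : ℕ, visitTime X (k - 1) ≤ t ∧ (t : ℕ∞) ≤ visitTime X k ∧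
        c + 1 ≤ pile (letters X) t 1 := by
  constructor
  · intro h
    by_contra! hcon
    have h1 : excursionHeight X k ≤ c := by
      refine iSup₂_le fun t ht => ?_
      have := hcon t ht.1 ht.2
      rw [height_eq_pile, Nat.cast_le]
      omega
    have h2 := h.trans h1
    rw [Nat.cast_le] at h2
    omega
  · rintro ⟨t, h1, h2, h3⟩
    rw [← height_eq_pile] at h3
    exact (Nat.cast_le.2 h3).trans
      (le_iSup₂ (f := fun (t : ℕ) (_ : t ∈ {t : ℕ | visitTime X (k - 1) ≤ t ∧
        (t : ℕ∞) ≤ visitTime X k}) => (height X t : ℕ∞)) t ⟨h1, h2⟩)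

/-- The half-open interval of the excursion is kept in the conclusion: these intervals are disjoint,
so different excursions yield different times. -/
theorem exists_gain_lt_of_excursion {κ : ℕ} {X : ℕ → Fin (κ + 1)} {n k c : ℕ}
    (hk : k < numVisits X n) (h : ((c + 1 : ℕ) : ℕ∞) ≤ excursionHeight X (k + 1)) :
    ∃ u : ℕ, visitTime X k ≤ u ∧ (u : ℕ∞) < visitTime X (k + 1) ∧ u < n ∧
      gain c (letters X) u < gain (c + 1) (letters X) u := by
  obtain ⟨t, h1, h2, h3⟩ := (le_excursionHeight_iff X (k + 1) c).1 h
  rw [Nat.add_sub_cancel] at h1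
  have h4 := (visitTime_le_iff X (k + 1) n).2 hk
  obtain ⟨s, hs⟩ := ENat.ne_top_iff_exists.1 (ne_top_of_le_ne_top (ENat.natCast_ne_top t) h1)
  rw [← hs, Nat.cast_le] at h1
  obtain ⟨u, hu1, hu2, hu3⟩ := exists_gain_lt (pile_visitTime hs.symm) h1 h3
  have h5 : (u : ℕ∞) < t := Nat.cast_lt.2 hu2
  have h6 : (u : ℕ∞) < n := h5.trans_le (h2.trans h4)
  exact ⟨u, by rw [← hs]; exact Nat.cast_le.2 hu1, h5.trans_le h2, Nat.cast_lt.1 h6, hu3⟩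

/-- Every completed excursion of height greater than `c` contributes to the difference of the
energies for the capacities `c + 1` and `c`. -/
theorem energy_add_card_le {κ : ℕ} (X : ℕ → Fin (κ + 1)) (n c : ℕ) :
    energy c (letters X) n + ((Finset.range (numVisits X n)).filter fun k =>
      ((c + 1 : ℕ) : ℕ∞) ≤ excursionHeight X (k + 1)).card ≤ energy (c + 1) (letters X) n := by
  choose! f hf using fun (k : ℕ) (hk : k < numVisits X n ∧
    ((c + 1 : ℕ) : ℕ∞) ≤ excursionHeight X (k + 1)) => exists_gain_lt_of_excursion hk.1 hk.2
  set G := (Finset.range n).filter fun u =>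
    gain c (letters X) u < gain (c + 1) (letters X) u with hG
  have hcard : ((Finset.range (numVisits X n)).filter fun k =>
      ((c + 1 : ℕ) : ℕ∞) ≤ excursionHeight X (k + 1)).card ≤ G.card := by
    refine Finset.card_le_card_of_injOn f (fun k hk => ?_) fun k hk l hl hkl => ?_
    · simp only [Finset.coe_filter, Finset.mem_range, Set.mem_ofPred_eq] at hk
      obtain ⟨-, -, h3, h4⟩ := hf k hk
      simp only [hG, Finset.coe_filter, Finset.mem_range, Set.mem_ofPred_eq]
      exact ⟨h3, h4⟩
    · simp only [Finset.coe_filter, Finset.mem_range, Set.mem_ofPred_eq] at hk hl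
      have key : ∀ a b, visitTime X b ≤ f b → (f a : ℕ∞) < visitTime X (a + 1) → f a = f b →
          b ≤ a := fun a b h1 h2 h3 => by
        by_contra hab
        have h4 := visitTime_mono X (show a + 1 ≤ b by omega)
        rw [h3] at h2
        exact absurd (h2.trans_le (h4.trans h1)) (lt_irrefl _)
      obtain ⟨a1, a2, -⟩ := hf k hk
      obtain ⟨b1, b2, -⟩ := hf l hl
      exact le_antisymm (key l k a1 b2 hkl.symm) (key k l b1 a2 hkl)
  have hsum : energy c (letters X) n + G.card ≤ energy (c + 1) (letters X) n := by
    rw [hG, Finset.card_filter, energy, energy, ← Finset.sum_add_distrib]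
    refine Finset.sum_le_sum fun u _ => ?_
    have := gain_mono (Nat.le_succ c) (letters X) u
    rw [Nat.succ_eq_add_one] at this
    split_ifs <;> omega
  omega

/-! ### Order statistics -/

theorem le_getD_iff {α : Type*} [LinearOrder α] [Zero α] {a : α} (ha : 0 < a) {l : List α}
    (hl : l.Pairwise (· ≥ ·)) (i : ℕ) :
    a ≤ l.getD i 0 ↔ i < l.countP (fun b => decide (a ≤ b)) := by
  induction l generalizing i with
  | nil => simpa using ha
  | cons b l ih =>
    rw [List.pairwise_cons] at hl
    by_cases hab : a ≤ b
    · rw [List.countP_cons_of_pos (by simpa using hab)]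
      cases i with
      | zero => simpa using hab
      | succ i =>
        rw [List.getD_cons_succ, ih hl.2]
        omega
    · have h0 : l.countP (fun b => decide (a ≤ b)) = 0 := by
        rw [List.countP_eq_zero]
        intro x hx
        have := hl.1 x hx
        simpa using (this.trans_lt (not_le.1 hab))
      rw [List.countP_cons_of_neg (by simpa using hab), h0]
      cases i with
      | zero => simpa using hab
      | succ i =>
        rw [List.getD_cons_succ, ih hl.2, h0]
        omega

theorem le_nthLargest_iff {α : Type*} [LinearOrder α] [Zero α] {a : α} (ha : 0 < a) (l : List α)
    {j : ℕ} (hj : 1 ≤ j) :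
    a ≤ nthLargest l j ↔ j ≤ l.countP (fun b => decide (a ≤ b)) := by
  have hs : (l.mergeSort fun a b => decide (b ≤ a)).Pairwise (· ≥ ·) := by
    refine (List.pairwise_mergeSort (le := fun a b : α => decide (b ≤ a)) ?_ ?_ l).imp ?_
    · intro a b c h1 h2
      simp only [decide_eq_true_eq] at *
      exact h2.trans h1
    · intro a b
      simpa using le_total b a
    · intro a b h
      simpa using h
  rw [nthLargest, le_getD_iff ha hs, (List.mergeSort_perm l _).countP_eq]
  omega

theorem solitonLength_eq {κ : ℕ} {Y : Config κ} {L : List (List (Fin (κ + 1)))}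
    (hL : IsSolitonDecomposition Y L) (j : ℕ) :
    solitonLength Y j = nthLargest (L.map List.length) j := by
  have h : ∃ L, IsSolitonDecomposition Y L := ⟨L, hL⟩
  rw [solitonLength, dif_pos h, h.choose_spec.unique hL]

theorem countP_range_map {α : Type*} (f : ℕ → α) (p : α → Prop) [DecidablePred p] (m : ℕ) :
    ((List.range m).map f).countP (fun b => decide (p b)) =
      ((Finset.range m).filter fun k => p (f k)).card := by
  induction m with
  | zero => rfl
  | succ m ih =>
    rw [List.range_succ, List.map_append, List.countP_append, ih, Finset.range_add_one,
      Finset.filter_insert]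
    split_ifs with h
    · rw [Finset.card_insert_of_notMem (by simp)]
      simp [h]
    · simp [h]

/-- Finite thresholds suffice, and they also exclude an infinite `h`. -/
theorem ENat.le_coe_of_forall {h : ℕ∞} {l : ℕ} (H : ∀ c : ℕ, ((c + 1 : ℕ) : ℕ∞) ≤ h → c + 1 ≤ l) :
    h ≤ l := by
  by_contra! hlt
  have := H l (by
    rw [Nat.cast_add, Nat.cast_one]
    exact Order.add_one_le_of_lt hlt)
  omega

end BoxBall

/-! ### Soliton lengths against excursion heights, threshold by threshold -/

theorem lemma4p1 {κ : ℕ} (hκ : 1 ≤ κ) {Ω : Type*} [MeasurableSpace Ω] (μ : Measure Ω)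
    [IsProbabilityMeasure μ] (p : PMF (Fin (κ + 1))) (X : ℕ → Ω → Fin (κ + 1))
    (hmeas : ∀ x, Measurable (X x)) (hindep : iIndepFun X μ)
    (hlaw : ∀ x, μ.map (X x) = p.toMeasure) (ω : Ω) (n : ℕ) (hn : 1 ≤ n) :
    (∃ L, BoxBall.IsSolitonDecomposition (BoxBall.truncate (fun x => X x ω) n) L) ∧
    (BoxBall.maxExcursionHeight (fun x => X x ω) (BoxBall.numVisits (fun x => X x ω) n) ≤
        (BoxBall.solitonLength (BoxBall.truncate (fun x => X x ω) n) 1 : ℕ∞) ∧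
      (BoxBall.solitonLength (BoxBall.truncate (fun x => X x ω) n) 1 : ℕ∞) ≤
        BoxBall.maxExcursionHeight (fun x => X x ω)
          (BoxBall.numVisits (fun x => X x ω) n + 1)) ∧
    ∀ j : ℕ, 1 ≤ j → BoxBall.orderedHeight (fun x => X x ω) n j ≤
      (BoxBall.solitonLength (BoxBall.truncate (fun x => X x ω) n) j : ℕ∞) := by
  open BoxBall in
  set x : ℕ → Fin (κ + 1) := fun t => X t ω
  obtain ⟨s, -, hL⟩ := exists_isSolitonDecomposition (truncate x n)
  set L := ballRuns (evolve^[s] (truncate x n))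
  have hen := hL.countP_truncate hκ
  have hcard : ∀ c, ((Finset.range (numVisits x n)).filter fun k =>
      ((c + 1 : ℕ) : ℕ∞) ≤ excursionHeight x (k + 1)).card ≤
        (L.map List.length).countP (fun l => decide (c + 1 ≤ l)) := fun c => by
    have h1 := energy_add_card_le x n c
    have h2 := hen c
    omega
  simp only [solitonLength_eq hL]
  refine ⟨⟨L, hL⟩, ⟨Finset.sup_le fun k hk => ?_, ?_⟩, fun j hj => ?_⟩
  · rw [Finset.mem_Icc] at hk
    refine BoxBall.ENat.le_coe_of_forall fun c hc => ?_
    rw [le_nthLargest_iff (show 0 < c + 1 by omega) _ le_rfl]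
    refine le_trans (Finset.card_pos.2 ⟨k - 1, ?_⟩) (hcard c)
    rw [Finset.mem_filter, Finset.mem_range, Nat.sub_add_cancel hk.1]
    exact ⟨by omega, hc⟩
  · rcases hl : nthLargest (L.map List.length) 1 with _ | c
    · simp
    · have h1 := (le_nthLargest_iff (show 0 < c + 1 by omega) (L.map List.length) le_rfl).1 hl.ge
      have h2 := hen c
      -- A soliton of length `c + 1` separates the two energies, so the carrier exceeds height `c`
      -- at some time `t ≤ n`.
      have h3 : ¬ ∀ u ≤ n, pile (letters x) u 1 ≤ c := fun h => by
        have := energy_succ_eq_of_pile_le h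
        omega
      push Not at h3
      obtain ⟨t, ht, htc⟩ := h3
      have h4 := numVisits_mono x ht
      -- The time `t` lies in the excursion after the last visit up to `t`, which may still be
      -- unfinished at time `n`; hence the index `M_n + 1` in the bound.
      refine le_trans ?_ (Finset.le_sup (f := excursionHeight x) (b := numVisits x t + 1)
        (Finset.mem_Icc.2 ⟨by omega, by omega⟩))
      refine (le_excursionHeight_iff x _ c).2 ⟨t, (visitTime_le_iff x _ t).2 le_rfl, ?_, htc⟩
      refine le_of_lt (not_le.1 fun h => ?_)
      have := (visitTime_le_iff x _ t).1 h
      omega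
  · refine BoxBall.ENat.le_coe_of_forall fun c hc => ?_
    rw [orderedHeight, le_nthLargest_iff (by positivity) _ hj, countP_range_map] at hc
    rw [le_nthLargest_iff (show 0 < c + 1 by omega) _ hj]
    exact hc.trans (hcard c)
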